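/- For $k\ge 1$, $n\ge 2$ and vectors $\vec\alpha_j=(\alpha_{j1},\dots,\alpha_{j,n-1})\in\mathbb R^{n-1}$, $1\le j\le k$, let $nHT_{\vec\alpha_1,\dots,\vec\alpha_k}$ be the $n$-linear operator defined on Schwartz functions $f,f_1,\dots,f_{n-1}$ on $\mathbb R$ by $$nHT_{\vec\alpha_1,\dots,\vec\alpha_k}(f,f_1,\dots,f_{n-1})(x)=\int_{\mathbb R^n}\Big[\prod_{j=1}^k\operatorname{sgn}(\xi+\alpha_{j1}\xi_1+\dots+\alpha_{j,n-1}\xi_{n-1})\Big]\hat f(\xi)\hat f_1(\xi_1)\cdots\hat f_{n-1}(\xi_{n-1})\,e^{2\pi i x(\xi+\xi_1+\dots+\xi_{n-1})}\,d\xi\,d\xi_1\cdots d\xi_{n-1},$$ where $\hat f(\xi)=\int_{\mathbb R} f(x)e^{-2\pi i x\xi}\,dx$. **Theorem.** Let $k\ge 2$ and $n\ge 4$. Then for generic vectors $\vec\alpha_1,\dots,\vec\alpha_k\in\mathbb R^{n-1}$, i.e. for all $(\vec\alpha_1,\dots,\vec\alpha_k)\in(\mathbb R^{n-1})^k$ outside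 the zero set of some nonzero real polynomial in the $k(n-1)$ entries (which depends only on $k$ and $n$), the operator $nHT_{\vec\alpha_1,\dots,\vec\alpha_k}$ satisfies no $L^p$ estimate of Hölder type: for all exponents $1<p_1,\dots,p_n\le\infty$ and $0<p<\infty$ with $1/p_1+\dots+1/p_n=1/p$, there is no finite constant $C$ such that $$\|nHT_{\vec\alpha_1,\dots,\vec\alpha_k}(f,f_1,\dots,f_{n-1})\|_{L^p}\le C\,\|f\|_{L^{p_1}}\|f_1\|_{L^{p_2}}\cdots\|f_{n-1}\|_{L^{p_n}}$$ for all Schwartz functions $f,f_1,\dots,f_{n-1}$. -/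

import Mathlib

open MeasureTheory
open scoped FourierTransform SchwartzMap ENNReal NNReal

noncomputable section

namespace MultilinearHilbert

/-- The product symbol
`∏ j, sgn (ξ₀ + α j 1 * ξ₁ + ⋯ + α j d * ξ_d)` on `ℝ^(d+1)` attached to `k` vectors
`α j` of `ℝ^d`. The coordinate `ξ 0` carries the coefficient `1`. -/
def symbol {d k : ℕ} (α : Fin k → Fin d → ℝ) (ξ : Fin (d + 1) → ℝ) : ℝ :=
  ∏ j : Fin k, Real.sign (ξ 0 + ∑ i : Fin d, α j i * ξ i.succ)

/-- The `(d+1)`-linear multiplier operator with symbol `symbol α`, on Schwartz functions: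
`x ↦ ∫ symbol α ξ * ∏ i, (f i)^(ξ i) * e^{2πi x (ξ₀ + ⋯ + ξ_d)} dξ` over `ℝ^(d+1)`
with Lebesgue measure; the Fourier transform is the one with kernel `e^{-2πi x ξ}`.
The integrand is absolutely integrable. -/
def nHT {d k : ℕ} (α : Fin k → Fin d → ℝ) (f : Fin (d + 1) → 𝓢(ℝ, ℂ)) (x : ℝ) : ℂ :=
  ∫ ξ : Fin (d + 1) → ℝ,
    (symbol α ξ : ℂ) * (∏ i, 𝓕 (f i : ℝ → ℂ) (ξ i)) *
      Complex.exp (2 * Real.pi * Complex.I * x * ∑ i, (ξ i : ℂ))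

/-- The a priori bound `L^{p 0} × ⋯ × L^{p d} → L^q` on Schwartz functions. -/
def IsBoundedOnLp {d : ℕ} (T : (Fin (d + 1) → 𝓢(ℝ, ℂ)) → ℝ → ℂ)
    (p : Fin (d + 1) → ℝ≥0∞) (q : ℝ≥0∞) : Prop :=
  ∃ C : ℝ≥0, ∀ f : Fin (d + 1) → 𝓢(ℝ, ℂ),
    eLpNorm (T f) q volume ≤ C * ∏ i, eLpNorm (f i : ℝ → ℂ) (p i) volume

/-- The operator satisfies some `L^p` estimate of Hölder type: it is bounded for at least one
tuple of exponents `1 < p i ≤ ∞`, `0 < q < ∞` with `∑ i, 1 / p i = 1 / q` (and `1 / ∞ = 0`). -/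
def SatisfiesSomeHolderEstimate {d : ℕ} (T : (Fin (d + 1) → 𝓢(ℝ, ℂ)) → ℝ → ℂ) : Prop :=
  ∃ (p : Fin (d + 1) → ℝ≥0∞) (q : ℝ≥0∞),
    (∀ i, 1 < p i) ∧ 0 < q ∧ q < ∞ ∧ ∑ i, (p i)⁻¹ = q⁻¹ ∧ IsBoundedOnLp T p q

/-- A property holds for generic `k`-tuples of vectors of `ℝ^d`: it holds off the zero set of
some nonzero real polynomial in the `k * d` entries. -/
def HoldsForGeneric {d k : ℕ} (Q : (Fin k → Fin d → ℝ) → Prop) : Prop :=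
  ∃ P : MvPolynomial (Fin k × Fin d) ℝ, P ≠ 0 ∧
    ∀ α : Fin k → Fin d → ℝ, MvPolynomial.eval (fun ji => α ji.1 ji.2) P ≠ 0 → Q α

end MultilinearHilbert

end

/-!
The failure of every Hölder type estimate comes from a logarithmic divergence which is seen on
Gaussian chirps.

*Reduction to two signs.* For generic `α` there is a direction `w` on which the first two linear
forms vanish and all the others do not (`exists_direction`). Modulating the functions by the
frequencies `R wᵢ` does not change their `L^p` norms and translates the symbol by `R w`; as
`R → ∞` the other signs become constant. By Fatou's lemma, a Hölder type estimate for the full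
symbol gives a bound for the operator with symbol `sgn (u · ξ) sgn (v · ξ)` on unmodulated
functions (`exists_eLpNorm_doubleSign_le`).

*Chirps.* In physical space the operator with two signs is, up to a constant,
`p.v. ∬ ∏ fᵢ(x + uᵢ t + vᵢ s) dt ds / (t s)`. It is tested on
`fᵢ(x) = exp (-π (1 + i L aᵢ) x²)`, whose `L^p` norms do not depend on `L`. With at least four
functions, there are generically coefficients `a` with
`∑ aᵢ uᵢ = ∑ aᵢ vᵢ = ∑ aᵢ vᵢ² = 0` and `∑ aᵢ uᵢ vᵢ = b ≠ 0` (`exists_chirp_coeff`), and then the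
phase in the integral is, up to a function of `x`, equal to `-π L (2 b t s + a' t²)`. The integral
in `s` is close to `∓ i π sgn t` once `|t| ≫ 1 / L`, and the phase `a' t²` is harmless for
`|t| ≪ L ^ (-1/2)`, so the remaining integral `∫ dt / |t|` is of order `log L`. This happens for all
`x` near `0`, which is incompatible with a bound uniform in `L`.

*The estimate.* The principal value of a complex Gaussian with quadratic form
`A t² + 2 B t s + C s²` and linear form `2 (D t + E s)` is called `pvGauss A B C D E`. Two
interpolations reduce it to explicit Gaussian integrals. Scaling the linear terms changes it only by
an amount controlled by the real part of the quadratic form (`norm_pvGauss_sub_le`): the derivative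
is a one-dimensional principal value whose linear coefficient is bounded by the square root of the
real part of its quadratic coefficient, thanks to `Coercive.schur`. Without linear terms, scaling
`B` gives
`pvGauss A B C 0 0 = -2 π B ∫₀¹ C^(-1/2) (A - θ² B² / C)^(-1/2) dθ`, which is at least of order
`log L` (`log_le_norm_pvGauss`). To avoid convergence questions, the signs are first replaced by
Gaussian regularizations `smoothSign δ`, which only adds `δ²` to `A` and `C`; all bounds are uniform
in `δ`.
-/

namespace MultilinearHilbert

/-! ### Alternating sums of two-dimensional complex Gaussians -/

/-- The Gaussian `exp (-π (A t² + 2 B t s + C s²) - 2π (D t + E s))` with complex coefficients. -/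
noncomputable def gauss (A B C D E : ℂ) (t s : ℝ) : ℂ :=
  Complex.exp (-(Real.pi * (A * t ^ 2 + 2 * B * t * s + C * s ^ 2) + 2 * Real.pi * (D * t + E * s)))

/-- The second difference of `H` which is odd in each of the two variables. -/
def altSum (H : ℝ → ℝ → ℂ) (t s : ℝ) : ℂ := H t s - H (-t) s - H t (-s) + H (-t) (-s)

/-- The real part of the quadratic form `A t² + 2 B t s + C s²` is at least `κ (t² + s²)`. -/
def Coercive (κ : ℝ) (A B C : ℂ) : Prop :=
  ∀ t s : ℝ, κ * (t ^ 2 + s ^ 2) ≤ A.re * t ^ 2 + 2 * B.re * t * s + C.re * s ^ 2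

lemma Coercive.symm {κ : ℝ} {A B C : ℂ} (h : Coercive κ A B C) : Coercive κ C B A := by
  intro t s; have := h s t; linarith

lemma Coercive.re_left {κ : ℝ} {A B C : ℂ} (h : Coercive κ A B C) : κ ≤ A.re := by
  simpa using h 1 0

lemma Coercive.mul_middle {κ : ℝ} {A B C : ℂ} (h : Coercive κ A B C) {θ : ℝ} (hθ : |θ| ≤ 1) :
    Coercive κ A (θ * B) C := by
  intro t s
  have h1 := h t s
  have h2 := h t (-s)
  obtain ⟨h3, h4⟩ := abs_le.1 hθ
  have : ((θ : ℂ) * B).re = θ * B.re := by simp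
  rw [this]
  nlinarith [mul_nonneg (by linarith : 0 ≤ 1 + θ) (sub_nonneg.2 h1),
    mul_nonneg (by linarith : 0 ≤ 1 - θ) (sub_nonneg.2 h2)]

lemma gauss_neg_left (A B C D E : ℂ) (t s : ℝ) :
    gauss A B C D E (-t) s = gauss A (-B) C (-D) E t s := by
  simp only [gauss]; congr 1; push_cast; ring

lemma gauss_neg_right (A B C D E : ℂ) (t s : ℝ) :
    gauss A B C D E t (-s) = gauss A (-B) C D (-E) t s := by
  simp only [gauss]; congr 1; push_cast; ring

lemma gauss_swap (A B C D E : ℂ) (t s : ℝ) :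
    gauss A B C D E t s = gauss C B A E D s t := by
  simp only [gauss]; congr 1; ring

@[fun_prop]
lemma continuous_gauss (A B C D E : ℂ) :
    Continuous (fun p : ℝ × ℝ => gauss A B C D E p.1 p.2) := by
  unfold gauss; fun_prop

/-- A real Gaussian dominating `gauss A B C D E` when the form is `κ`-coercive and
`‖D‖² + ‖E‖² ≤ r`; half of the coercivity is spent on absorbing the linear terms. -/
noncomputable def gaussBound (κ r t s : ℝ) : ℝ :=
  Real.exp (2 * Real.pi * r / κ) * Real.exp (-(Real.pi * κ / 2) * (t ^ 2 + s ^ 2))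

lemma gaussBound_pos (κ r t s : ℝ) : 0 < gaussBound κ r t s := by unfold gaussBound; positivity

lemma norm_gauss_le {κ : ℝ} (hκ : 0 < κ) {A B C D E : ℂ} (h : Coercive κ A B C) {r : ℝ}
    (hr : ‖D‖ ^ 2 + ‖E‖ ^ 2 ≤ r) (t s : ℝ) :
    ‖gauss A B C D E t s‖ ≤ gaussBound κ r t s := by
  rw [gauss, Complex.norm_exp, gaussBound, ← Real.exp_add, Real.exp_le_exp]
  have h1 := h t s
  have e : (-(Real.pi * (A * t ^ 2 + 2 * B * t * s + C * s ^ 2) +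
      2 * Real.pi * (D * t + E * s)) : ℂ).re =
      -(Real.pi * (A.re * t ^ 2 + 2 * B.re * t * s + C.re * s ^ 2) +
      2 * Real.pi * (D.re * t + E.re * s)) := by
    simp [pow_two]
  rw [e]
  have key : ∀ x : ℝ, ∀ z : ℂ, -(2 * (z.re * x)) ≤ κ / 2 * x ^ 2 + 2 * ‖z‖ ^ 2 / κ := by
    intro x z
    have h2 : |z.re| ≤ ‖z‖ := Complex.abs_re_le_norm z
    have h3 : z.re ^ 2 ≤ ‖z‖ ^ 2 := by
      rw [← sq_abs]; gcongr
    have h4 : κ / 2 * x ^ 2 + 2 * z.re ^ 2 / κ + 2 * (z.re * x) =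
      (κ * x + 2 * z.re) ^ 2 / (2 * κ) := by field_simp; ring
    have h5 : 0 ≤ (κ * x + 2 * z.re) ^ 2 / (2 * κ) := by positivity
    have h6 : 2 * z.re ^ 2 / κ ≤ 2 * ‖z‖ ^ 2 / κ := by gcongr
    linarith
  have h2 := key t D
  have h3 := key s E
  have h4 : 2 * ‖D‖ ^ 2 / κ + 2 * ‖E‖ ^ 2 / κ ≤ 2 * r / κ := by
    rw [← add_div]; gcongr; linarith
  have h5 : -(A.re * t ^ 2 + 2 * B.re * t * s + C.re * s ^ 2) - 2 * (D.re * t) - 2 * (E.re * s) ≤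
    2 * r / κ - κ / 2 * (t ^ 2 + s ^ 2) := by linarith
  have h6 := mul_le_mul_of_nonneg_left h5 Real.pi_pos.le
  calc _ = Real.pi * (-(A.re * t ^ 2 + 2 * B.re * t * s + C.re * s ^ 2) - 2 * (D.re * t)
        - 2 * (E.re * s)) := by ring
    _ ≤ _ := h6
    _ = _ := by ring

/-- Scaling `B` and `E` together by `σ` amounts to scaling `s` in all terms but `C s²`; `σ = 1` and
`σ = -1` correspond to the points `(t, s)` and `(t, -s)`. -/
lemma hasDerivAt_gauss_right (A B C D E : ℂ) (t s σ : ℝ) :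
    HasDerivAt (fun σ : ℝ => gauss A (σ * B) C D (σ * E) t s)
      (-(2 * Real.pi * (B * t + E) * s) * gauss A (σ * B) C D (σ * E) t s) σ := by
  unfold gauss
  have h : HasDerivAt (fun σ : ℝ => (-(Real.pi * (A * t ^ 2 + 2 * (σ * B) * t * s + C * s ^ 2) +
      2 * Real.pi * (D * t + (σ * E) * s)) : ℂ)) (-(2 * Real.pi * (B * t + E) * s)) σ := by
    have h0 : HasDerivAt (fun σ : ℝ => (σ : ℂ)) 1 σ := Complex.ofRealCLM.hasDerivAt
    have := ((h0.mul_const (-(2 * Real.pi * (B * t + E) * s) : ℂ)).add_const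
      (-(Real.pi * (A * t ^ 2 + C * s ^ 2) + 2 * Real.pi * (D * t)) : ℂ))
    rw [one_mul] at this
    refine this.congr_of_eventuallyEq (Filter.Eventually.of_forall fun x => ?_)
    simp only; ring
  convert! h.cexp using 1
  ring

lemma norm_gauss_sub_neg_right_le {κ : ℝ} (hκ : 0 < κ) {A B C D E : ℂ} (h : Coercive κ A B C)
    {r : ℝ} (hr : ‖D‖ ^ 2 + ‖E‖ ^ 2 ≤ r) (t s : ℝ) :
    ‖gauss A B C D E t s - gauss A B C D E t (-s)‖ ≤
      4 * Real.pi * (‖B‖ * |t| + ‖E‖) * |s| * gaussBound κ r t s := by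
  have hb : ∀ σ ∈ Set.Icc (-1 : ℝ) 1, ‖-(2 * Real.pi * (B * t + E) * s) *
      gauss A (σ * B) C D (σ * E) t s‖ ≤
      2 * Real.pi * (‖B‖ * |t| + ‖E‖) * |s| * gaussBound κ r t s := by
    intro σ hσ
    have hσ' : |σ| ≤ 1 := abs_le.2 hσ
    rw [norm_mul]
    refine mul_le_mul ?_ (norm_gauss_le hκ (h.mul_middle hσ') ?_ t s) (norm_nonneg _) (by positivity)
    · rw [norm_neg, norm_mul, norm_mul, norm_mul, Complex.norm_real, Complex.norm_real,
        Real.norm_eq_abs, Real.norm_eq_abs, abs_of_pos Real.pi_pos]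
      have : ‖B * t + E‖ ≤ ‖B‖ * |t| + ‖E‖ := by
        refine (norm_add_le _ _).trans ?_
        rw [norm_mul, Complex.norm_real, Real.norm_eq_abs]
      simp only [Complex.norm_ofNat]
      gcongr
    · have : ‖(σ : ℂ) * E‖ ≤ ‖E‖ := by
        rw [norm_mul, Complex.norm_real, Real.norm_eq_abs]
        exact mul_le_of_le_one_left (norm_nonneg _) hσ'
      have : ‖(σ : ℂ) * E‖ ^ 2 ≤ ‖E‖ ^ 2 := by gcongr
      linarith
  have := (convex_Icc (-1 : ℝ) 1).norm_image_sub_le_of_norm_hasDerivWithin_le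
    (fun σ _ => (hasDerivAt_gauss_right A B C D E t s σ).hasDerivWithinAt) hb
    (Set.left_mem_Icc.2 (by norm_num)) (Set.right_mem_Icc.2 (by norm_num))
  rw [gauss_neg_right]
  norm_num at this
  refine this.trans (le_of_eq ?_)
  ring

lemma norm_gauss_sub_neg_left_le {κ : ℝ} (hκ : 0 < κ) {A B C D E : ℂ} (h : Coercive κ A B C)
    {r : ℝ} (hr : ‖D‖ ^ 2 + ‖E‖ ^ 2 ≤ r) (t s : ℝ) :
    ‖gauss A B C D E t s - gauss A B C D E (-t) s‖ ≤
      4 * Real.pi * (‖B‖ * |s| + ‖D‖) * |t| * gaussBound κ r t s := by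
  rw [gauss_swap, gauss_swap _ _ _ _ _ (-t)]
  convert! norm_gauss_sub_neg_right_le hκ h.symm (by linarith : ‖E‖ ^ 2 + ‖D‖ ^ 2 ≤ r) s t using 2
  simp only [gaussBound]; rw [add_comm]

lemma hasDerivAt_gauss_left (A B C D E : ℂ) (t s σ : ℝ) :
    HasDerivAt (fun σ : ℝ => gauss A (σ * B) C (σ * D) E t s)
      (-(2 * Real.pi * (B * s + D) * t) * gauss A (σ * B) C (σ * D) E t s) σ := by
  have := hasDerivAt_gauss_right C B A E D s t σ
  rw [gauss_swap]
  refine this.congr_of_eventuallyEq (Filter.Eventually.of_forall fun x => ?_)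
  exact gauss_swap _ _ _ _ _ _ _

/-- The second difference vanishes to first order in each variable, which makes its quotient by
`t s` integrable near the axes. -/
lemma norm_altSum_gauss_le {κ : ℝ} (hκ : 0 < κ) {A B C D E : ℂ} (h : Coercive κ A B C)
    {r : ℝ} (hr : ‖D‖ ^ 2 + ‖E‖ ^ 2 ≤ r) (t s : ℝ) :
    ‖altSum (gauss A B C D E) t s‖ ≤
      8 * Real.pi * (‖B‖ + 2 * Real.pi * ‖D‖ * (‖B‖ * |t| + ‖E‖)) * gaussBound κ r t s
        * (|t| * |s|) := by
  set Γ := gaussBound κ r t s with hΓ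
  have hΓ0 : 0 < Γ := gaussBound_pos _ _ _ _
  have hΓs : gaussBound κ r t (-s) = Γ := by simp [hΓ, gaussBound]
  -- the second difference is the increment on `[-1, 1]` of a first difference in `s`
  have hd : ∀ σ : ℝ, HasDerivAt (fun σ : ℝ => gauss A (σ * B) C (σ * D) E t s -
      gauss A (σ * B) C (σ * D) E t (-s))
      (-(2 * Real.pi * t) * (B * s * (gauss A (σ * B) C (σ * D) E t s +
        gauss A (σ * B) C (σ * D) E t (-s)) + D * (gauss A (σ * B) C (σ * D) E t s -
      gauss A (σ * B) C (σ * D) E t (-s)))) σ := by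
    intro σ
    convert! (hasDerivAt_gauss_left A B C D E t s σ).sub
      (hasDerivAt_gauss_left A B C D E t (-s) σ) using 1
    push_cast; ring
  have hb : ∀ σ ∈ Set.Icc (-1 : ℝ) 1,
      ‖-(2 * Real.pi * t) * (B * s * (gauss A (σ * B) C (σ * D) E t s +
        gauss A (σ * B) C (σ * D) E t (-s)) + D * (gauss A (σ * B) C (σ * D) E t s -
      gauss A (σ * B) C (σ * D) E t (-s)))‖ ≤
      2 * Real.pi * |t| * (‖B‖ * |s| * (Γ + Γ) +
        ‖D‖ * (4 * Real.pi * (‖B‖ * |t| + ‖E‖) * |s| * Γ)) := by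
    intro σ hσ
    have hσ' : |σ| ≤ 1 := abs_le.2 hσ
    have hle : ∀ z : ℂ, ‖(σ : ℂ) * z‖ ≤ ‖z‖ := fun z => by
      rw [norm_mul, Complex.norm_real, Real.norm_eq_abs]
      exact mul_le_of_le_one_left (norm_nonneg _) hσ'
    have hr' : ‖(σ : ℂ) * D‖ ^ 2 + ‖E‖ ^ 2 ≤ r := by
      have : ‖(σ : ℂ) * D‖ ^ 2 ≤ ‖D‖ ^ 2 := by gcongr; exact hle D
      linarith
    have hc := h.mul_middle hσ'
    have h1 := norm_gauss_le hκ hc hr' t s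
    have h2 := norm_gauss_le hκ hc hr' t (-s)
    rw [hΓs] at h2
    have h3 := norm_gauss_sub_neg_right_le hκ hc hr' t s
    have h4 : ‖gauss A (σ * B) C (σ * D) E t s - gauss A (σ * B) C (σ * D) E t (-s)‖ ≤
        4 * Real.pi * (‖B‖ * |t| + ‖E‖) * |s| * Γ := by
      refine h3.trans ?_
      gcongr
      exact hle B
    have e : ‖(-(2 * Real.pi * t) : ℂ)‖ = 2 * Real.pi * |t| := by
      simp [abs_of_pos Real.pi_pos]
    rw [norm_mul, e]
    gcongr
    refine (norm_add_le _ _).trans ?_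
    rw [norm_mul, norm_mul, norm_mul, Complex.norm_real, Real.norm_eq_abs]
    gcongr
    exact (norm_add_le _ _).trans (by gcongr)
  have := (convex_Icc (-1 : ℝ) 1).norm_image_sub_le_of_norm_hasDerivWithin_le
    (fun σ _ => (hd σ).hasDerivWithinAt) hb
    (Set.left_mem_Icc.2 (by norm_num)) (Set.right_mem_Icc.2 (by norm_num))
  rw [altSum, gauss_neg_left, gauss_neg_left]
  norm_num at this
  rw [show gauss A B C D E t s - gauss A (-B) C (-D) E t s - gauss A B C D E t (-s) +
    gauss A (-B) C (-D) E t (-s) = gauss A B C D E t s - gauss A B C D E t (-s) -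
     (gauss A (-B) C (-D) E t s - gauss A (-B) C (-D) E t (-s)) by ring]
  refine this.trans (le_of_eq ?_)
  ring

lemma integrable_abs_mul_gaussBound {κ : ℝ} (hκ : 0 < κ) (r a b : ℝ) :
    Integrable (fun p : ℝ × ℝ => (a + b * |p.1|) * gaussBound κ r p.1 p.2) := by
  have hc : 0 < Real.pi * κ / 2 := by positivity
  have h0 := integrable_exp_neg_mul_sq hc
  have h1 : Integrable (fun x : ℝ => (a + b * |x|) * Real.exp (-(Real.pi * κ / 2) * x ^ 2)) := by
    have := ((integrable_mul_exp_neg_mul_sq hc).norm.const_mul b).add (h0.const_mul a)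
    refine this.congr (Filter.Eventually.of_forall fun x => ?_)
    simp only [Pi.add_apply, norm_mul, Real.norm_eq_abs, Real.abs_exp]
    ring
  refine ((h1.mul_prod h0).const_mul (Real.exp (2 * Real.pi * r / κ))).congr
    (Filter.Eventually.of_forall fun p => ?_)
  simp only [gaussBound, mul_add, Real.exp_add]
  ring

/-- The open first quadrant. -/
abbrev quadrant : Set (ℝ × ℝ) := Set.Ioi 0 ×ˢ Set.Ioi 0

lemma measurableSet_quadrant : MeasurableSet quadrant := measurableSet_Ioi.prod measurableSet_Ioi

/-- The double principal value integral of `gauss A B C D E t s / (t s)`, written as an absolutely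
convergent integral of second differences over the quadrant. -/
noncomputable def pvGauss (A B C D E : ℂ) : ℂ :=
  ∫ p in quadrant, altSum (gauss A B C D E) p.1 p.2 / (p.1 * p.2)

@[fun_prop]
lemma continuous_altSum_gauss (A B C D E : ℂ) :
    Continuous (fun p : ℝ × ℝ => altSum (gauss A B C D E) p.1 p.2) := by
  have := continuous_gauss A B C D E
  have h1 : Continuous (fun p : ℝ × ℝ => gauss A B C D E (-p.1) p.2) :=
    this.comp (g := fun p : ℝ × ℝ => gauss A B C D E p.1 p.2)
      (f := fun p : ℝ × ℝ => (-p.1, p.2)) (by fun_prop)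
  have h2 : Continuous (fun p : ℝ × ℝ => gauss A B C D E (p.1) (-p.2)) :=
    this.comp (g := fun p : ℝ × ℝ => gauss A B C D E p.1 p.2)
      (f := fun p : ℝ × ℝ => (p.1, -p.2)) (by fun_prop)
  have h3 : Continuous (fun p : ℝ × ℝ => gauss A B C D E (-p.1) (-p.2)) :=
    this.comp (g := fun p : ℝ × ℝ => gauss A B C D E p.1 p.2)
      (f := fun p : ℝ × ℝ => (-p.1, -p.2)) (by fun_prop)
  unfold altSum
  exact ((this.sub h1).sub h2).add h3

lemma aestronglyMeasurable_altSum_gauss_div (A B C D E : ℂ) (μ : Measure (ℝ × ℝ)) :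
    AEStronglyMeasurable
      (fun p : ℝ × ℝ => altSum (gauss A B C D E) p.1 p.2 / (p.1 * p.2)) μ := by
  apply Measurable.aestronglyMeasurable
  exact (continuous_altSum_gauss A B C D E).measurable.div (by fun_prop)

lemma norm_altSum_gauss_div_le {κ : ℝ} (hκ : 0 < κ) {A B C D E : ℂ} (h : Coercive κ A B C)
    {r : ℝ} (hr : ‖D‖ ^ 2 + ‖E‖ ^ 2 ≤ r) {p : ℝ × ℝ} (hp : p ∈ quadrant) :
    ‖altSum (gauss A B C D E) p.1 p.2 / (p.1 * p.2)‖ ≤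
      (8 * Real.pi * (‖B‖ + 2 * Real.pi * ‖D‖ * ‖E‖) +
        16 * Real.pi ^ 2 * ‖D‖ * ‖B‖ * |p.1|) * gaussBound κ r p.1 p.2 := by
  have h1 : 0 < p.1 := hp.1
  have h2 : 0 < p.2 := hp.2
  rw [norm_div, norm_mul, Complex.norm_real, Complex.norm_real, Real.norm_eq_abs,
    Real.norm_eq_abs, div_le_iff₀ (by positivity)]
  refine (norm_altSum_gauss_le hκ h hr _ _).trans (le_of_eq ?_)
  ring

lemma integrableOn_altSum_gauss_div {κ : ℝ} (hκ : 0 < κ) {A B C D E : ℂ} (h : Coercive κ A B C) :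
    IntegrableOn (fun p : ℝ × ℝ => altSum (gauss A B C D E) p.1 p.2 / (p.1 * p.2)) quadrant := by
  refine Integrable.mono' (integrable_abs_mul_gaussBound hκ (‖D‖ ^ 2 + ‖E‖ ^ 2) _ _).integrableOn
    (aestronglyMeasurable_altSum_gauss_div _ _ _ _ _ _)
    ((ae_restrict_iff' measurableSet_quadrant).2 (Filter.Eventually.of_forall fun p hp =>
      norm_altSum_gauss_div_le hκ h le_rfl hp))

/-! ### Uniform control of the linear terms -/

lemma Coercive.ne_zero_right {κ : ℝ} (hκ : 0 < κ) {A B C : ℂ} (h : Coercive κ A B C) : C ≠ 0 := by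
  intro hC
  have := h.symm.re_left
  rw [hC, Complex.zero_re] at this
  linarith

lemma Coercive.norm_right {κ : ℝ} {A B C : ℂ} (h : Coercive κ A B C) : κ ≤ ‖C‖ :=
  h.symm.re_left.trans (Complex.re_le_norm C)

/-- The Hermitian form of the complex symmetric matrix `[A B; B C]` at the vector `(C, -B)`
controls the Schur complement `A - B² / C`. -/
lemma Coercive.schur {κ : ℝ} (hκ : 0 < κ) {A B C : ℂ} (h : Coercive κ A B C) :
    κ * (‖B‖ ^ 2 + ‖C‖ ^ 2) ≤ ‖C‖ ^ 2 * (A - B ^ 2 / C).re := by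
  have hC := h.ne_zero_right hκ
  have e : ‖C‖ ^ 2 * (A - B ^ 2 / C).re =
      ((starRingEnd ℂ C) * (C * A - B ^ 2)).re := by
    have : (starRingEnd ℂ C) * (C * A - B ^ 2) = ((‖C‖ ^ 2 : ℝ) : ℂ) * (A - B ^ 2 / C) := by
      rw [← Complex.normSq_eq_norm_sq, Complex.normSq_eq_conj_mul_self]
      field_simp
    rw [this, Complex.re_ofReal_mul]
  rw [e]
  have h1 := h C.re (-B.re)
  have h2 := h C.im (-B.im)
  rw [← Complex.normSq_eq_norm_sq, ← Complex.normSq_eq_norm_sq, Complex.normSq_apply,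
    Complex.normSq_apply]
  simp only [pow_two, Complex.mul_re, Complex.conj_re, Complex.conj_im, Complex.sub_re,
    Complex.sub_im, Complex.mul_im]
  linarith

lemma integral_gauss_right {κ : ℝ} (hκ : 0 < κ) {A B C : ℂ} (h : Coercive κ A B C) (D E : ℂ)
    (t : ℝ) : ∫ s : ℝ, gauss A B C D E t s =
      (1 / C) ^ (1 / 2 : ℂ) * Complex.exp (Real.pi * E ^ 2 / C) *
        Complex.exp (-Real.pi * (A - B ^ 2 / C) * t ^ 2 + 2 * Real.pi * (B * E / C - D) * t) := by
  have hC := h.ne_zero_right hκ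
  have hre : (-Real.pi * C : ℂ).re < 0 := by
    have := h.symm.re_left
    have h3 : 0 < C.re := by linarith
    have : (-Real.pi * C : ℂ).re = -(Real.pi * C.re) := by simp
    rw [this]
    have := mul_pos Real.pi_pos h3
    linarith
  have hpi : (Real.pi : ℂ) ≠ 0 := by exact_mod_cast Real.pi_ne_zero
  have := integral_cexp_quadratic hre (-2 * Real.pi * (B * t + E))
    (-Real.pi * A * t ^ 2 - 2 * Real.pi * D * t)
  rw [mul_assoc, ← Complex.exp_add]
  convert! this using 2
  · ext s
    simp only [gauss]; congr 1; ring
  · congr 1; field_simp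
  · congr 1; field_simp; ring

/-- The difference of `H` which is even in the second variable and odd in the first. -/
def oddEvenSum (H : ℝ → ℝ → ℂ) (t s : ℝ) : ℂ := H t s + H t (-s) - H (-t) s - H (-t) (-s)

lemma norm_oddEvenSum_gauss_le {κ : ℝ} (hκ : 0 < κ) {A B C D E : ℂ} (h : Coercive κ A B C)
    {r : ℝ} (hr : ‖D‖ ^ 2 + ‖E‖ ^ 2 ≤ r) {p : ℝ × ℝ} (hp : p ∈ quadrant) :
    ‖oddEvenSum (gauss A B C D E) p.1 p.2 / p.1‖ ≤
      (8 * Real.pi * (‖B‖ * |p.2| + ‖D‖)) * gaussBound κ r p.1 p.2 := by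
  have h1 : 0 < p.1 := hp.1
  have e1 := norm_gauss_sub_neg_left_le hκ h hr p.1 p.2
  have e2 := norm_gauss_sub_neg_left_le hκ h hr p.1 (-p.2)
  have e3 : gaussBound κ r p.1 (-p.2) = gaussBound κ r p.1 p.2 := by simp [gaussBound]
  rw [e3, abs_neg] at e2
  rw [norm_div, Complex.norm_real, Real.norm_eq_abs, div_le_iff₀ (by positivity), oddEvenSum]
  rw [show gauss A B C D E p.1 p.2 + gauss A B C D E p.1 (-p.2) - gauss A B C D E (-p.1) p.2 -
    gauss A B C D E (-p.1) (-p.2) = (gauss A B C D E p.1 p.2 - gauss A B C D E (-p.1) p.2) +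
      (gauss A B C D E p.1 (-p.2) - gauss A B C D E (-p.1) (-p.2)) by ring]
  refine (norm_add_le _ _).trans ((add_le_add e1 e2).trans (le_of_eq ?_))
  ring

lemma aestronglyMeasurable_oddEvenSum (A B C D E : ℂ) (μ : Measure (ℝ × ℝ)) :
    AEStronglyMeasurable
      (fun p : ℝ × ℝ => oddEvenSum (gauss A B C D E) p.1 p.2 / p.1) μ := by
  apply Measurable.aestronglyMeasurable
  have := (continuous_gauss A B C D E).measurable
  have h1 : Measurable (fun p : ℝ × ℝ => gauss A B C D E (-p.1) p.2) :=
    this.comp (g := fun p : ℝ × ℝ => gauss A B C D E p.1 p.2)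
      (f := fun p : ℝ × ℝ => (-p.1, p.2)) (by fun_prop)
  have h2 : Measurable (fun p : ℝ × ℝ => gauss A B C D E (p.1) (-p.2)) :=
    this.comp (g := fun p : ℝ × ℝ => gauss A B C D E p.1 p.2)
      (f := fun p : ℝ × ℝ => (p.1, -p.2)) (by fun_prop)
  have h3 : Measurable (fun p : ℝ × ℝ => gauss A B C D E (-p.1) (-p.2)) :=
    this.comp (g := fun p : ℝ × ℝ => gauss A B C D E p.1 p.2)
      (f := fun p : ℝ × ℝ => (-p.1, -p.2)) (by fun_prop)
  unfold oddEvenSum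
  exact (((this.add h2).sub h1).sub h3).div (by fun_prop)

lemma integrable_abs_snd_mul_gaussBound {κ : ℝ} (hκ : 0 < κ) (r a b : ℝ) :
    Integrable (fun p : ℝ × ℝ => (a + b * |p.2|) * gaussBound κ r p.1 p.2) := by
  refine (integrable_abs_mul_gaussBound hκ r a b).swap.congr
    (Filter.Eventually.of_forall fun p => ?_)
  simp only [Function.comp, gaussBound, Prod.fst_swap, Prod.snd_swap, add_comm]

lemma integrableOn_oddEvenSum {κ : ℝ} (hκ : 0 < κ) {A B C : ℂ} (h : Coercive κ A B C) (D E : ℂ) :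
    IntegrableOn (fun p : ℝ × ℝ => oddEvenSum (gauss A B C D E) p.1 p.2 / p.1) quadrant := by
  refine Integrable.mono' (integrable_abs_snd_mul_gaussBound hκ (‖D‖ ^ 2 + ‖E‖ ^ 2)
    (8 * Real.pi * ‖D‖) (8 * Real.pi * ‖B‖)).integrableOn
    (aestronglyMeasurable_oddEvenSum _ _ _ _ _ _)
    ((ae_restrict_iff' measurableSet_quadrant).2 (Filter.Eventually.of_forall fun p hp =>
      (norm_oddEvenSum_gauss_le hκ h le_rfl hp).trans (le_of_eq (by ring))))

lemma integral_Ioi_add_neg {f : ℝ → ℂ} (hf : Integrable f) :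
    ∫ x in Set.Ioi 0, (f x + f (-x)) = ∫ x, f x := by
  rw [integral_add hf.integrableOn hf.comp_neg.integrableOn, integral_comp_neg_Ioi, neg_zero,
    add_comm]
  exact intervalIntegral.integral_Iic_add_Ioi hf.integrableOn hf.integrableOn

lemma integrable_gauss_right {κ : ℝ} (hκ : 0 < κ) {A B C : ℂ} (h : Coercive κ A B C) (D E : ℂ)
    (t : ℝ) : Integrable (fun s => gauss A B C D E t s) := by
  have hre : (-Real.pi * C : ℂ).re < 0 := by
    have := h.symm.re_left
    have h3 : 0 < C.re := by linarith
    have : (-Real.pi * C : ℂ).re = -(Real.pi * C.re) := by simp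
    rw [this]
    have := mul_pos Real.pi_pos h3
    linarith
  refine (integrable_cexp_quadratic' hre (-2 * Real.pi * (B * t + E))
    (-Real.pi * A * t ^ 2 - 2 * Real.pi * D * t)).congr (Filter.Eventually.of_forall fun s => ?_)
  simp only [gauss]; congr 1; ring

lemma norm_exp_sub_exp_neg_le (z : ℂ) :
    ‖Complex.exp z - Complex.exp (-z)‖ ≤ 2 * ‖z‖ * Real.exp ‖z‖ := by
  have key : ∀ w : ℂ, ‖Complex.exp w - 1‖ ≤ ‖w‖ * Real.exp ‖w‖ := fun w => by
    simpa using Complex.norm_exp_sub_sum_le_norm_mul_exp w 1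
  have h1 := key z
  have h2 := key (-z)
  rw [norm_neg] at h2
  calc _ = ‖(Complex.exp z - 1) - (Complex.exp (-z) - 1)‖ := by ring_nf
    _ ≤ _ := norm_sub_le _ _
    _ ≤ _ := by linarith

lemma norm_one_div_cpow_half (C : ℂ) :
    ‖(1 / C) ^ (1 / 2 : ℂ)‖ = (Real.sqrt ‖C‖)⁻¹ := by
  have : (1 / 2 : ℂ) = ((1 / 2 : ℝ) : ℂ) := by push_cast; rfl
  rw [this, Complex.norm_cpow_real, norm_div, norm_one, one_div,
    Real.inv_rpow (norm_nonneg _), Real.sqrt_eq_rpow]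

/-- Bound for a one-dimensional principal value of a Gaussian whose linear coefficient is at most
of the order of the square root of its quadratic coefficient. -/
lemma integral_Ioi_linear_gauss_le {K g : ℝ} {f : ℝ → ℂ} {F : ℂ} (hg : 0 < g)
    (hK : 0 ≤ K) (hF : ‖F‖ ≤ K * Real.sqrt g)
    (hf : ∀ t > 0, ‖f t‖ ≤ Real.exp (-Real.pi * g * t ^ 2) *
      (2 * ‖2 * Real.pi * F * t‖ * Real.exp ‖2 * Real.pi * F * t‖ / t)) :
    ‖∫ t in Set.Ioi 0, f t‖ ≤ 4 * Real.pi * K * Real.exp (2 * Real.pi * K ^ 2) := by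
  have hc : 0 < Real.pi * g / 2 := by positivity
  have hb : ∀ t ∈ Set.Ioi (0 : ℝ), ‖f t‖ ≤
      4 * Real.pi * K * Real.sqrt g * Real.exp (2 * Real.pi * K ^ 2) *
        Real.exp (-(Real.pi * g / 2) * t ^ 2) := by
    intro t (ht : 0 < t)
    have e : ‖2 * Real.pi * F * t‖ = 2 * Real.pi * ‖F‖ * t := by
      simp [abs_of_pos Real.pi_pos, abs_of_pos ht]
    refine (hf t ht).trans ?_
    rw [e, show 2 * (2 * Real.pi * ‖F‖ * t) * Real.exp (2 * Real.pi * ‖F‖ * t) / t =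
      4 * Real.pi * ‖F‖ * Real.exp (2 * Real.pi * ‖F‖ * t) by field_simp; ring]
    have h1 : Real.exp (-Real.pi * g * t ^ 2) * Real.exp (2 * Real.pi * ‖F‖ * t) ≤
        Real.exp (2 * Real.pi * K ^ 2) * Real.exp (-(Real.pi * g / 2) * t ^ 2) := by
      rw [← Real.exp_add, ← Real.exp_add, Real.exp_le_exp]
      have h2 : ‖F‖ * t ≤ K * Real.sqrt g * t := by gcongr
      have h3 : Real.sqrt g ^ 2 = g := Real.sq_sqrt hg.le
      have h4 : 2 * (K * Real.sqrt g * t) ≤ 2 * K ^ 2 + g * t ^ 2 / 2 := by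
        have := sq_nonneg (2 * K - Real.sqrt g * t)
        have h5 : (Real.sqrt g * t) ^ 2 = g * t ^ 2 := by rw [mul_pow, h3]
        linarith
      have h6 : 2 * (‖F‖ * t) - g * t ^ 2 ≤ 2 * K ^ 2 - g * t ^ 2 / 2 := by linarith
      have := mul_le_mul_of_nonneg_left h6 Real.pi_pos.le
      linarith
    calc _ = 4 * Real.pi * ‖F‖ * (Real.exp (-Real.pi * g * t ^ 2) *
          Real.exp (2 * Real.pi * ‖F‖ * t)) := by ring
      _ ≤ 4 * Real.pi * (K * Real.sqrt g) * (Real.exp (2 * Real.pi * K ^ 2) *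
          Real.exp (-(Real.pi * g / 2) * t ^ 2)) := by gcongr
      _ = _ := by ring
  refine (norm_integral_le_of_norm_le ((integrable_exp_neg_mul_sq hc).integrableOn.const_mul _)
    ((ae_restrict_iff' measurableSet_Ioi).2 (Filter.Eventually.of_forall hb))).trans ?_
  rw [integral_const_mul, integral_gaussian_Ioi]
  have h7 : Real.sqrt g * Real.sqrt (Real.pi / (Real.pi * g / 2)) = Real.sqrt 2 := by
    rw [← Real.sqrt_mul hg.le]
    congr 1
    field_simp
  have h8 : Real.sqrt 2 / 2 ≤ 1 := by
    have : Real.sqrt 2 ≤ 2 := by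
      rw [Real.sqrt_le_left (by norm_num)]; norm_num
    linarith
  calc _ = 4 * Real.pi * K * Real.exp (2 * Real.pi * K ^ 2) *
        (Real.sqrt g * Real.sqrt (Real.pi / (Real.pi * g / 2)) / 2) := by ring
    _ ≤ 4 * Real.pi * K * Real.exp (2 * Real.pi * K ^ 2) * 1 := by
        rw [h7]; gcongr
    _ = _ := by ring

/-- The constant in the uniform bound for the principal value in one variable. -/
noncomputable def linearBound (κ r : ℝ) : ℝ :=
  (Real.sqrt κ)⁻¹ * Real.exp (Real.pi * r / κ) *
    (4 * Real.pi * Real.sqrt (r / κ) * Real.exp (2 * Real.pi * Real.sqrt (r / κ) ^ 2))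

/-- The bound depends only on the real part of the quadratic form: however large the imaginary
parts are, the linear coefficient left after integrating out `s` is dominated by the square
root of the Schur complement. -/
lemma norm_integral_oddEvenSum_le {κ : ℝ} (hκ : 0 < κ) {A B C D E : ℂ} (h : Coercive κ A B C)
    {r : ℝ} (hr : ‖D‖ ^ 2 + ‖E‖ ^ 2 ≤ r) :
    ‖∫ p in quadrant, oddEvenSum (gauss A B C D E) p.1 p.2 / p.1‖ ≤ linearBound κ r := by
  have hC := h.ne_zero_right hκ
  have hC' : 0 < ‖C‖ := norm_pos_iff.2 hC
  have hr0 : 0 ≤ r := le_trans (by positivity) hr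
  set G := A - B ^ 2 / C with hG
  set F := B * E / C - D with hF
  have hS : κ * (‖B‖ ^ 2 + ‖C‖ ^ 2) ≤ ‖C‖ ^ 2 * G.re := h.schur hκ
  have hg : 0 < G.re := by
    have h1 : 0 < ‖C‖ ^ 2 * G.re := lt_of_lt_of_le (by positivity) hS
    exact pos_of_mul_pos_right h1 (by positivity)
  have hFK : ‖F‖ ≤ Real.sqrt (r / κ) * Real.sqrt G.re := by
    rw [← Real.sqrt_mul (by positivity)]
    apply Real.le_sqrt_of_sq_le
    have h1 : ‖C‖ * ‖F‖ ≤ ‖B‖ * ‖E‖ + ‖C‖ * ‖D‖ := by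
      rw [← norm_mul, ← norm_mul, ← norm_mul]
      have : C * F = B * E - C * D := by rw [hF]; field_simp
      rw [this]; exact norm_sub_le _ _
    have h2 : (‖C‖ * ‖F‖) ^ 2 ≤ (‖D‖ ^ 2 + ‖E‖ ^ 2) * (‖B‖ ^ 2 + ‖C‖ ^ 2) := by
      refine (pow_le_pow_left₀ (by positivity) h1 2).trans ?_
      nlinarith [sq_nonneg (‖B‖ * ‖D‖ - ‖C‖ * ‖E‖)]
    have h3 : (‖D‖ ^ 2 + ‖E‖ ^ 2) * (‖B‖ ^ 2 + ‖C‖ ^ 2) ≤ r * (‖C‖ ^ 2 * G.re / κ) := by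
      gcongr
      rw [le_div_iff₀ hκ]; linarith
    have h4 : ‖C‖ ^ 2 * ‖F‖ ^ 2 ≤ ‖C‖ ^ 2 * (r / κ * G.re) := by
      calc _ = (‖C‖ * ‖F‖) ^ 2 := by ring
        _ ≤ _ := h2.trans h3
        _ = _ := by ring
    exact le_of_mul_le_mul_left h4 (by positivity)
  have e : ∫ p in quadrant, oddEvenSum (gauss A B C D E) p.1 p.2 / p.1 =
      (1 / C) ^ (1 / 2 : ℂ) * Complex.exp (Real.pi * E ^ 2 / C) *
      ∫ t in Set.Ioi (0 : ℝ), Complex.exp (-Real.pi * G * t ^ 2) *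
        (Complex.exp (2 * Real.pi * F * t) - Complex.exp (-(2 * Real.pi * F * t))) / t := by
    rw [← integral_const_mul, Measure.volume_eq_prod,
      setIntegral_prod _ (integrableOn_oddEvenSum hκ h D E)]
    refine setIntegral_congr_fun measurableSet_Ioi fun t _ => ?_
    have e1 : ∀ s : ℝ, oddEvenSum (gauss A B C D E) t s / t =
        ((gauss A B C D E t s + gauss A B C D E t (-s)) -
          (gauss A B C D E (-t) s + gauss A B C D E (-t) (-s))) / t := by
      intro s; rw [oddEvenSum]; ring
    simp only [e1]
    have i1 := fun x : ℝ => (integrable_gauss_right hκ h D E x).integrableOn (s := Set.Ioi 0)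
    have i2 := fun x : ℝ => (integrable_gauss_right hκ h D E x).comp_neg.integrableOn
      (s := Set.Ioi 0)
    have i3 : ∀ x : ℝ, IntegrableOn (fun s => gauss A B C D E x s + gauss A B C D E x (-s))
        (Set.Ioi 0) := fun x => (i1 x).add (i2 x)
    rw [integral_div, integral_sub (i3 t) (i3 (-t)),
      integral_Ioi_add_neg (integrable_gauss_right hκ h D E t),
      integral_Ioi_add_neg (integrable_gauss_right hκ h D E (-t)),
      integral_gauss_right hκ h, integral_gauss_right hκ h]
    simp only [Complex.exp_add]
    push_cast
    rw [show (-Real.pi * (A - B ^ 2 / C) * (-(t : ℂ)) ^ 2) = -Real.pi * G * t ^ 2 by rw [hG]; ring,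
      show (2 * Real.pi * (B * E / C - D) * (-(t : ℂ))) = -(2 * Real.pi * F * t) by rw [hF]; ring]
    ring
  have hI : ‖∫ t in Set.Ioi (0 : ℝ), Complex.exp (-Real.pi * G * t ^ 2) *
        (Complex.exp (2 * Real.pi * F * t) - Complex.exp (-(2 * Real.pi * F * t))) / t‖ ≤
      4 * Real.pi * Real.sqrt (r / κ) * Real.exp (2 * Real.pi * Real.sqrt (r / κ) ^ 2) := by
    refine integral_Ioi_linear_gauss_le hg (Real.sqrt_nonneg _) hFK fun t ht => ?_
    rw [norm_div, norm_mul, Complex.norm_exp, Complex.norm_real, Real.norm_eq_abs, abs_of_pos ht,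
      mul_div_assoc]
    have : (-Real.pi * G * t ^ 2 : ℂ).re = -Real.pi * G.re * t ^ 2 := by
      rw [show (-Real.pi * G * t ^ 2 : ℂ) = ((-Real.pi * t ^ 2 : ℝ) : ℂ) * G by push_cast; ring,
        Complex.re_ofReal_mul]
      ring
    rw [this]
    gcongr
    exact norm_exp_sub_exp_neg_le _
  rw [e, norm_mul, norm_mul, linearBound, norm_one_div_cpow_half C, Complex.norm_exp]
  have hκC := h.norm_right
  gcongr
  refine (Complex.re_le_norm _).trans ?_
  rw [norm_div, norm_mul, norm_pow, Complex.norm_real, Real.norm_eq_abs, abs_of_pos Real.pi_pos]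
  gcongr
  nlinarith [sq_nonneg ‖D‖]

/-! ### Variation of the principal value along the coefficients -/

lemma hasDerivAt_gauss_linear (A B C D E : ℂ) (t s η : ℝ) :
    HasDerivAt (fun η : ℝ => gauss A B C (η * D) (η * E) t s)
      (-(2 * Real.pi * (D * t + E * s)) * gauss A B C (η * D) (η * E) t s) η := by
  unfold gauss
  have h : HasDerivAt (fun η : ℝ => (-(Real.pi * (A * t ^ 2 + 2 * B * t * s + C * s ^ 2) +
      2 * Real.pi * ((η * D) * t + (η * E) * s)) : ℂ)) (-(2 * Real.pi * (D * t + E * s))) η := by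
    have h0 : HasDerivAt (fun η : ℝ => (η : ℂ)) 1 η := Complex.ofRealCLM.hasDerivAt
    have := ((h0.mul_const (-(2 * Real.pi * (D * t + E * s)) : ℂ)).add_const
      (-(Real.pi * (A * t ^ 2 + 2 * B * t * s + C * s ^ 2)) : ℂ))
    rw [one_mul] at this
    refine this.congr_of_eventuallyEq (Filter.Eventually.of_forall fun x => ?_)
    simp only; ring
  convert! h.cexp using 1
  ring

lemma hasDerivAt_altSum_gauss_linear (A B C D E : ℂ) {p : ℝ × ℝ} (hp : p ∈ quadrant) (η : ℝ) :
    HasDerivAt (fun η : ℝ => altSum (gauss A B C (η * D) (η * E)) p.1 p.2 / (p.1 * p.2))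
      (-(2 * Real.pi) * (D * (oddEvenSum (gauss C B A (η * E) (η * D)) p.2 p.1 / p.2) +
        E * (oddEvenSum (gauss A B C (η * D) (η * E)) p.1 p.2 / p.1))) η := by
  have h1 : (p.1 : ℂ) ≠ 0 := by exact_mod_cast (show 0 < p.1 from hp.1).ne'
  have h2 : (p.2 : ℂ) ≠ 0 := by exact_mod_cast (show 0 < p.2 from hp.2).ne'
  unfold altSum
  convert! ((((hasDerivAt_gauss_linear A B C D E p.1 p.2 η).sub
    (hasDerivAt_gauss_linear A B C D E (-p.1) p.2 η)).sub
    (hasDerivAt_gauss_linear A B C D E p.1 (-p.2) η)).add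
    (hasDerivAt_gauss_linear A B C D E (-p.1) (-p.2) η)).div_const ((p.1 : ℂ) * p.2) using 1
  simp only [oddEvenSum, gauss_swap C]
  push_cast
  field_simp
  ring

lemma integrableOn_oddEvenSum_swap {κ : ℝ} (hκ : 0 < κ) {A B C : ℂ} (h : Coercive κ A B C)
    (D E : ℂ) :
    IntegrableOn (fun p : ℝ × ℝ => oddEvenSum (gauss C B A E D) p.2 p.1 / p.2) quadrant := by
  have := (integrableOn_oddEvenSum hκ h.symm E D)
  rw [IntegrableOn, Measure.volume_eq_prod, ← Measure.prod_restrict] at this ⊢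
  exact this.swap

lemma norm_integral_oddEvenSum_swap_le {κ : ℝ} (hκ : 0 < κ) {A B C D E : ℂ}
    (h : Coercive κ A B C) {r : ℝ} (hr : ‖D‖ ^ 2 + ‖E‖ ^ 2 ≤ r) :
    ‖∫ p in quadrant, oddEvenSum (gauss C B A E D) p.2 p.1 / p.2‖ ≤ linearBound κ r := by
  have := norm_integral_oddEvenSum_le hκ h.symm (by linarith : ‖E‖ ^ 2 + ‖D‖ ^ 2 ≤ r)
  rw [Measure.volume_eq_prod, ← setIntegral_prod_swap] at this
  exact this

lemma norm_ofReal_mul_le {η : ℝ} (hη : |η| ≤ 2) (D : ℂ) : ‖(η : ℂ) * D‖ ≤ 2 * ‖D‖ := by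
  rw [norm_mul, Complex.norm_real, Real.norm_eq_abs]; gcongr

lemma hasDerivAt_pvGauss_linear {κ : ℝ} (hκ : 0 < κ) {A B C : ℂ} (h : Coercive κ A B C)
    (D E : ℂ) {η : ℝ} (hη : η ∈ Set.Ioo (-2 : ℝ) 2) :
    HasDerivAt (fun η : ℝ => pvGauss A B C (η * D) (η * E))
      (∫ p in quadrant, (-(2 * Real.pi) *
        (D * (oddEvenSum (gauss C B A (η * E) (η * D)) p.2 p.1 / p.2) +
        E * (oddEvenSum (gauss A B C (η * D) (η * E)) p.1 p.2 / p.1)) : ℂ)) η := by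
  set r := 4 * (‖D‖ ^ 2 + ‖E‖ ^ 2) with hr
  have hrη : ∀ x ∈ Set.Ioo (-2 : ℝ) 2, ‖(x : ℂ) * D‖ ^ 2 + ‖(x : ℂ) * E‖ ^ 2 ≤ r := by
    intro x hx
    have hx' : |x| ≤ 2 := (abs_lt.2 hx).le
    have h1 := pow_le_pow_left₀ (norm_nonneg _) (norm_ofReal_mul_le hx' D) 2
    have h2 := pow_le_pow_left₀ (norm_nonneg _) (norm_ofReal_mul_le hx' E) 2
    rw [hr]; linarith
  refine (hasDerivAt_integral_of_dominated_loc_of_deriv_le (μ := volume.restrict quadrant)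
    (F := fun (η : ℝ) (p : ℝ × ℝ) => altSum (gauss A B C (η * D) (η * E)) p.1 p.2 / (p.1 * p.2))
    (F' := fun (η : ℝ) (p : ℝ × ℝ) => -(2 * Real.pi) *
        (D * (oddEvenSum (gauss C B A (η * E) (η * D)) p.2 p.1 / p.2) +
        E * (oddEvenSum (gauss A B C (η * D) (η * E)) p.1 p.2 / p.1)))
    (bound := fun p => 2 * Real.pi *
      (‖D‖ * ((8 * Real.pi * (2 * ‖E‖) + 8 * Real.pi * ‖B‖ * |p.1|) * gaussBound κ r p.1 p.2) +
        ‖E‖ * ((8 * Real.pi * (2 * ‖D‖) + 8 * Real.pi * ‖B‖ * |p.2|) * gaussBound κ r p.1 p.2)))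
    (isOpen_Ioo.mem_nhds hη)
    (Filter.Eventually.of_forall fun x => aestronglyMeasurable_altSum_gauss_div _ _ _ _ _ _)
    (integrableOn_altSum_gauss_div hκ h) ?_ ?_ ?_ ?_).2
  · have m1 := ((integrableOn_oddEvenSum_swap hκ h (η * D) (η * E)).const_mul D).add
      ((integrableOn_oddEvenSum hκ h (η * D) (η * E)).const_mul E)
    exact (m1.const_mul _).aestronglyMeasurable
  · refine (ae_restrict_iff' measurableSet_quadrant).2 (Filter.Eventually.of_forall
      fun p hp x hx => ?_)
    have hx' : |x| ≤ 2 := (abs_lt.2 hx).le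
    have b1 := norm_oddEvenSum_gauss_le hκ h (hrη x hx) hp
    have b2 := norm_oddEvenSum_gauss_le hκ h.symm
      (by linarith [hrη x hx] : ‖(x : ℂ) * E‖ ^ 2 + ‖(x : ℂ) * D‖ ^ 2 ≤ r) (p := p.swap)
      ⟨hp.2, hp.1⟩
    simp only [Prod.fst_swap, Prod.snd_swap] at b2
    have hΓ : gaussBound κ r p.2 p.1 = gaussBound κ r p.1 p.2 := by
      simp only [gaussBound, add_comm]
    rw [hΓ] at b2
    have hΓ0 := gaussBound_pos κ r p.1 p.2
    have e : ‖(-(2 * Real.pi) : ℂ)‖ = 2 * Real.pi := by simp [abs_of_pos Real.pi_pos]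
    rw [norm_mul, e]
    gcongr
    refine (norm_add_le _ _).trans ?_
    rw [norm_mul, norm_mul]
    gcongr
    · refine b2.trans ?_
      gcongr
      have := norm_ofReal_mul_le hx' E
      have := mul_le_mul_of_nonneg_left this (by positivity : 0 ≤ 8 * Real.pi)
      linarith
    · refine b1.trans ?_
      gcongr
      have := norm_ofReal_mul_le hx' D
      have := mul_le_mul_of_nonneg_left this (by positivity : 0 ≤ 8 * Real.pi)
      linarith
  · exact ((((integrable_abs_mul_gaussBound hκ _ _ _).const_mul _).add
      ((integrable_abs_snd_mul_gaussBound hκ _ _ _).const_mul _)).const_mul _).integrableOn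
  · exact (ae_restrict_iff' measurableSet_quadrant).2 (Filter.Eventually.of_forall
      fun p hp x _ => hasDerivAt_altSum_gauss_linear A B C D E hp x)

/-- Linear terms change the principal value by an amount controlled by the coercivity constant of
the real part alone. -/
lemma norm_pvGauss_sub_le {κ : ℝ} (hκ : 0 < κ) {A B C D E : ℂ} (h : Coercive κ A B C)
    (hr : ‖D‖ ^ 2 + ‖E‖ ^ 2 ≤ 1) :
    ‖pvGauss A B C D E - pvGauss A B C 0 0‖ ≤ 4 * Real.pi * linearBound κ 1 := by
  have hD : ‖D‖ ≤ 1 := by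
    have := sq_nonneg ‖E‖
    exact (sq_le_one_iff₀ (norm_nonneg _)).1 (by linarith)
  have hE : ‖E‖ ≤ 1 := by
    have := sq_nonneg ‖D‖
    exact (sq_le_one_iff₀ (norm_nonneg _)).1 (by linarith)
  have hb : ∀ η ∈ Set.Icc (0 : ℝ) 1, ‖∫ p in quadrant, (-(2 * Real.pi) *
        (D * (oddEvenSum (gauss C B A (η * E) (η * D)) p.2 p.1 / p.2) +
        E * (oddEvenSum (gauss A B C (η * D) (η * E)) p.1 p.2 / p.1)) : ℂ)‖ ≤
        4 * Real.pi * linearBound κ 1 := by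
    intro η hη
    have hle : ∀ z : ℂ, ‖(η : ℂ) * z‖ ≤ ‖z‖ := fun z => by
      rw [norm_mul, Complex.norm_real, Real.norm_eq_abs, abs_of_nonneg hη.1]
      exact mul_le_of_le_one_left (norm_nonneg _) hη.2
    have hr' : ‖(η : ℂ) * D‖ ^ 2 + ‖(η : ℂ) * E‖ ^ 2 ≤ 1 := by
      have h1 : ‖(η : ℂ) * D‖ ^ 2 ≤ ‖D‖ ^ 2 := by gcongr; exact hle D
      have h2 : ‖(η : ℂ) * E‖ ^ 2 ≤ ‖E‖ ^ 2 := by gcongr; exact hle E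
      linarith
    rw [integral_const_mul, integral_add
      ((integrableOn_oddEvenSum_swap hκ h (η * D) (η * E)).const_mul D)
      ((integrableOn_oddEvenSum hκ h (η * D) (η * E)).const_mul E), integral_const_mul,
      integral_const_mul]
    have e : ‖(-(2 * Real.pi) : ℂ)‖ = 2 * Real.pi := by simp [abs_of_pos Real.pi_pos]
    rw [norm_mul, e]
    have b1 := norm_integral_oddEvenSum_swap_le hκ h hr'
    have b2 := norm_integral_oddEvenSum_le hκ h hr'
    calc _ ≤ 2 * Real.pi * (1 * linearBound κ 1 + 1 * linearBound κ 1) := by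
          gcongr
          refine (norm_add_le _ _).trans ?_
          rw [norm_mul, norm_mul]
          gcongr
      _ = _ := by ring
  have := (convex_Icc (0 : ℝ) 1).norm_image_sub_le_of_norm_hasDerivWithin_le
    (fun η hη => (hasDerivAt_pvGauss_linear hκ h D E
      ⟨by linarith [hη.1], by linarith [hη.2]⟩).hasDerivWithinAt) hb
    (Set.left_mem_Icc.2 (by norm_num)) (Set.right_mem_Icc.2 (by norm_num))
  simpa using this

/-! ### The principal value without linear terms -/

lemma hasDerivAt_gauss_middle (A B C : ℂ) (t s θ : ℝ) :
    HasDerivAt (fun θ : ℝ => gauss A (θ * B) C 0 0 t s)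
      (-(2 * Real.pi * B) * (t * s) * gauss A (θ * B) C 0 0 t s) θ := by
  have := hasDerivAt_gauss_right A B C 0 0 t s θ
  simp only [mul_zero, add_zero] at this
  convert! this using 1
  ring

/-- The sum of `H` over the four reflections of a point. -/
def evenSum (H : ℝ → ℝ → ℂ) (t s : ℝ) : ℂ := H t s + H t (-s) + H (-t) s + H (-t) (-s)

lemma hasDerivAt_altSum_gauss_middle (A B C : ℂ) {p : ℝ × ℝ} (hp : p ∈ quadrant) (θ : ℝ) :
    HasDerivAt (fun θ : ℝ => altSum (gauss A (θ * B) C 0 0) p.1 p.2 / (p.1 * p.2))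
      (-(2 * Real.pi * B) * evenSum (gauss A (θ * B) C 0 0) p.1 p.2) θ := by
  have h1 : (p.1 : ℂ) ≠ 0 := by exact_mod_cast (show 0 < p.1 from hp.1).ne'
  have h2 : (p.2 : ℂ) ≠ 0 := by exact_mod_cast (show 0 < p.2 from hp.2).ne'
  unfold altSum
  convert! ((((hasDerivAt_gauss_middle A B C p.1 p.2 θ).sub
    (hasDerivAt_gauss_middle A B C (-p.1) p.2 θ)).sub
    (hasDerivAt_gauss_middle A B C p.1 (-p.2) θ)).add
    (hasDerivAt_gauss_middle A B C (-p.1) (-p.2) θ)).div_const ((p.1 : ℂ) * p.2) using 1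
  simp only [evenSum]
  push_cast
  field_simp
  ring

lemma integrable_gaussBound {κ : ℝ} (hκ : 0 < κ) (r : ℝ) :
    Integrable (fun p : ℝ × ℝ => gaussBound κ r p.1 p.2) := by
  simpa using integrable_abs_mul_gaussBound hκ r 1 0

lemma integrable_gauss {κ : ℝ} (hκ : 0 < κ) {A B C : ℂ} (h : Coercive κ A B C) (D E : ℂ) :
    Integrable (fun p : ℝ × ℝ => gauss A B C D E p.1 p.2) :=
  (integrable_gaussBound hκ _).mono' (continuous_gauss A B C D E).aestronglyMeasurable
    (Filter.Eventually.of_forall fun p => norm_gauss_le hκ h le_rfl p.1 p.2)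

lemma integrable_evenSum_gauss {κ : ℝ} (hκ : 0 < κ) {A B C : ℂ} (h : Coercive κ A B C) :
    Integrable (fun p : ℝ × ℝ => evenSum (gauss A B C 0 0) p.1 p.2) := by
  have h' : Coercive κ A (-B) C := by
    have := h.mul_middle (θ := -1) (by simp)
    simpa using this
  have i1 := integrable_gauss hκ h 0 0
  have i2 := integrable_gauss hκ h' 0 0
  refine (((i1.add i2).add i2).add i1).congr (Filter.Eventually.of_forall fun p => ?_)
  simp [evenSum, gauss_neg_left, gauss_neg_right]

lemma norm_evenSum_gauss_le {κ : ℝ} (hκ : 0 < κ) {A B C : ℂ} (h : Coercive κ A B C) (t s : ℝ) :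
    ‖evenSum (gauss A B C 0 0) t s‖ ≤ 4 * gaussBound κ 0 t s := by
  have b : ∀ x y : ℝ, ‖gauss A B C 0 0 x y‖ ≤ gaussBound κ 0 x y :=
    fun x y => norm_gauss_le hκ h (by simp) x y
  have h1 := b t s
  have h2 := b t (-s)
  have h3 := b (-t) s
  have h4 := b (-t) (-s)
  simp only [gaussBound, neg_sq] at h1 h2 h3 h4 ⊢
  unfold evenSum
  refine (norm_add_le _ _).trans ?_
  refine (add_le_add_left (norm_add_le _ _) _).trans ?_
  refine (add_le_add_left (add_le_add_left (norm_add_le _ _) _) _).trans ?_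
  linarith

lemma integral_quadrant_evenSum {κ : ℝ} (hκ : 0 < κ) {A B C : ℂ} (h : Coercive κ A B C) :
    ∫ p in quadrant, evenSum (gauss A B C 0 0) p.1 p.2 =
      (1 / C) ^ (1 / 2 : ℂ) * (1 / (A - B ^ 2 / C)) ^ (1 / 2 : ℂ) := by
  have hC := h.ne_zero_right hκ
  have hC' : 0 < ‖C‖ := norm_pos_iff.2 hC
  have hpi : (Real.pi : ℂ) ≠ 0 := by exact_mod_cast Real.pi_ne_zero
  have hg : 0 < (A - B ^ 2 / C).re := by
    have h1 : 0 < ‖C‖ ^ 2 * (A - B ^ 2 / C).re := lt_of_lt_of_le (by positivity) (h.schur hκ)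
    exact pos_of_mul_pos_right h1 (by positivity)
  rw [Measure.volume_eq_prod, setIntegral_prod _ (integrable_evenSum_gauss hκ h).integrableOn]
  have hre : 0 < (Real.pi * (A - B ^ 2 / C) : ℂ).re := by
    rw [Complex.re_ofReal_mul]; exact mul_pos Real.pi_pos hg
  have inner : ∀ t : ℝ, ∫ s in Set.Ioi (0 : ℝ), evenSum (gauss A B C 0 0) t s =
      2 * (1 / C) ^ (1 / 2 : ℂ) * Complex.exp (-(Real.pi * (A - B ^ 2 / C)) * t ^ 2) := by
    intro t
    have i1 := fun x : ℝ => (integrable_gauss_right hκ h 0 0 x).integrableOn (s := Set.Ioi 0)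
    have i2 := fun x : ℝ => (integrable_gauss_right hκ h 0 0 x).comp_neg.integrableOn
      (s := Set.Ioi 0)
    have i3 : ∀ x : ℝ, IntegrableOn (fun s => gauss A B C 0 0 x s + gauss A B C 0 0 x (-s))
        (Set.Ioi 0) := fun x => (i1 x).add (i2 x)
    simp only [evenSum, add_assoc]
    simp only [← add_assoc (gauss A B C 0 0 t _) (gauss A B C 0 0 t _)]
    rw [integral_add (i3 t) (i3 (-t)), integral_Ioi_add_neg (integrable_gauss_right hκ h 0 0 t),
      integral_Ioi_add_neg (integrable_gauss_right hκ h 0 0 (-t)), integral_gauss_right hκ h,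
      integral_gauss_right hκ h]
    simp
    ring
  simp only [inner]
  rw [integral_const_mul, integral_gaussian_complex_Ioi hre, div_mul_eq_div_div, div_self hpi]
  ring

lemma hasDerivAt_pvGauss_middle {κ : ℝ} (hκ : 0 < κ) {A B C : ℂ} (h : Coercive κ A B C)
    {θ : ℝ} (hθ : θ ∈ Set.Ioo (-1 : ℝ) 1) :
    HasDerivAt (fun θ : ℝ => pvGauss A (θ * B) C 0 0)
      (-(2 * Real.pi * B) * ((1 / C) ^ (1 / 2 : ℂ) *
        (1 / (A - (θ * B) ^ 2 / C)) ^ (1 / 2 : ℂ))) θ := by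
  have hc : ∀ x ∈ Set.Ioo (-1 : ℝ) 1, Coercive κ A (x * B) C := fun x hx =>
    h.mul_middle (abs_lt.2 hx).le
  have := (hasDerivAt_integral_of_dominated_loc_of_deriv_le (μ := volume.restrict quadrant)
    (F := fun (θ : ℝ) (p : ℝ × ℝ) => altSum (gauss A (θ * B) C 0 0) p.1 p.2 / (p.1 * p.2))
    (F' := fun (θ : ℝ) (p : ℝ × ℝ) =>
      -(2 * Real.pi * B) * evenSum (gauss A (θ * B) C 0 0) p.1 p.2)
    (bound := fun p => 2 * Real.pi * ‖B‖ * (4 * gaussBound κ 0 p.1 p.2))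
    (isOpen_Ioo.mem_nhds hθ)
    (Filter.Eventually.of_forall fun x => aestronglyMeasurable_altSum_gauss_div _ _ _ _ _ _)
    (integrableOn_altSum_gauss_div hκ (hc θ hθ)) ?_ ?_ ?_ ?_).2
  · rw [integral_const_mul, integral_quadrant_evenSum hκ (hc θ hθ)] at this
    exact this
  · have := (integrable_evenSum_gauss hκ (hc θ hθ)).aestronglyMeasurable.restrict (s := quadrant)
    exact this.const_mul _
  · refine Filter.Eventually.of_forall fun p x hx => ?_
    rw [norm_mul, norm_neg, norm_mul, norm_mul, Complex.norm_real, Real.norm_eq_abs,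
      abs_of_pos Real.pi_pos, Complex.norm_ofNat]
    gcongr
    exact norm_evenSum_gauss_le hκ (hc x hx) _ _
  · exact (((integrable_gaussBound hκ 0).const_mul 4).const_mul _).integrableOn
  · exact (ae_restrict_iff' measurableSet_quadrant).2 (Filter.Eventually.of_forall
      fun p hp x _ => hasDerivAt_altSum_gauss_middle A B C hp x)

lemma continuousOn_pvGauss_middle {κ : ℝ} (hκ : 0 < κ) {A B C : ℂ} (h : Coercive κ A B C) :
    ContinuousOn (fun θ : ℝ => pvGauss A (θ * B) C 0 0) (Set.Icc 0 1) := by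
  refine continuousOn_of_dominated (μ := volume.restrict quadrant)
    (F := fun (θ : ℝ) (p : ℝ × ℝ) => altSum (gauss A (θ * B) C 0 0) p.1 p.2 / (p.1 * p.2))
    (bound := fun p => 8 * Real.pi * ‖B‖ * gaussBound κ 0 p.1 p.2)
    (fun x _ => aestronglyMeasurable_altSum_gauss_div _ _ _ _ _ _) (fun x hx => ?_)
    ((integrable_gaussBound hκ 0).integrableOn.const_mul _)
    ((ae_restrict_iff' measurableSet_quadrant).2 (Filter.Eventually.of_forall fun p hp x _ =>
      (hasDerivAt_altSum_gauss_middle A B C hp x).continuousAt.continuousWithinAt))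
  refine (ae_restrict_iff' measurableSet_quadrant).2 (Filter.Eventually.of_forall fun p hp => ?_)
  have hx' : |x| ≤ 1 := by rw [abs_of_nonneg hx.1]; exact hx.2
  refine (norm_altSum_gauss_div_le hκ (h.mul_middle hx') (r := 0) (by simp) hp).trans ?_
  have hΓ0 := gaussBound_pos κ 0 p.1 p.2
  have : ‖(x : ℂ) * B‖ ≤ ‖B‖ := by
    rw [norm_mul, Complex.norm_real, Real.norm_eq_abs]
    exact mul_le_of_le_one_left (norm_nonneg _) hx'
  simp only [norm_zero, mul_zero, zero_mul, add_zero]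
  gcongr

lemma sqrt_half_norm_le_re_cpow_half {z : ℂ} (hz : 0 < z.re) :
    Real.sqrt (‖z‖ / 2) ≤ (z ^ (1 / 2 : ℂ)).re := by
  have h2 : (z ^ (1 / 2 : ℂ)) ^ 2 = z := by
    simp
  set y := z ^ (1 / 2 : ℂ) with hy
  have hre : 0 ≤ y.re := by
    rw [hy, show (1 / 2 : ℂ) = ((1 / 2 : ℝ) : ℂ) by push_cast; rfl, Complex.cpow_ofReal_re]
    refine mul_nonneg (Real.rpow_nonneg (norm_nonneg _) _) (Real.cos_nonneg_of_mem_Icc ?_)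
    have h3 := Complex.neg_pi_lt_arg z
    have h4 := Complex.arg_le_pi z
    constructor <;> linarith
  rw [Real.sqrt_le_left hre]
  have h3 : ‖z‖ = y.re ^ 2 + y.im ^ 2 := by
    rw [← h2, norm_pow, ← Complex.normSq_eq_norm_sq, Complex.normSq_apply]; ring
  have h4 : z.re = y.re ^ 2 - y.im ^ 2 := by
    rw [← h2]; simp [pow_two]
  linarith

lemma pvGauss_zero_middle (A C : ℂ) : pvGauss A 0 C 0 0 = 0 := by
  have : ∀ t s : ℝ, altSum (gauss A 0 C 0 0) t s = 0 := by
    intro t s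
    simp [altSum, gauss_neg_left, gauss_neg_right]
  simp [pvGauss, this]

/-- With an imaginary cross coefficient of size `L`, and a chirp in one of the two variables of
size at most `L`, the principal value grows at least like `log L`. -/
lemma log_le_norm_pvGauss {κ : ℝ} (hκ : 0 < κ) {A B : ℂ} {c : ℝ} (h : Coercive κ A B c)
    {M m L : ℝ} (hm : 0 < m) (hL : 1 ≤ L) (hA : ‖A‖ ≤ M * L) (hB : ‖B‖ ^ 2 ≤ M * c * L ^ 2)
    (hB' : m * L ≤ ‖B‖) :
    Real.pi * m * Real.log L / (2 * Real.sqrt M * Real.sqrt c) ≤ ‖pvGauss A B c 0 0‖ := by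
  have hc : 0 < c := by
    have := h.symm.re_left
    simp at this
    linarith
  have hL0 : 0 < L := by linarith
  have hB0 : 0 < ‖B‖ := lt_of_lt_of_le (by positivity) hB'
  have hBne : B ≠ 0 := norm_pos_iff.1 hB0
  have hcC : (c : ℂ) ≠ 0 := by exact_mod_cast hc.ne'
  have hM : 0 < M := by
    have h1 : 0 < M * c * L ^ 2 := lt_of_lt_of_le (by positivity) hB
    have h2 : 0 < M * (c * L ^ 2) := by linarith
    exact pos_of_mul_pos_left h2 (by positivity)
  set q : ℂ := (1 / (c : ℂ)) ^ (1 / 2 : ℂ) with hq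
  have hqn : ‖q‖ = (Real.sqrt c)⁻¹ := by
    rw [hq, norm_one_div_cpow_half, Complex.norm_real, Real.norm_eq_abs, abs_of_pos hc]
  have hq0 : q ≠ 0 := by
    rw [← norm_pos_iff, hqn]; positivity
  have hpi : (Real.pi : ℂ) ≠ 0 := by exact_mod_cast Real.pi_ne_zero
  set N : ℂ := -(2 * Real.pi * B) * q with hN
  have hN0 : N ≠ 0 := by
    rw [hN]; exact mul_ne_zero (neg_ne_zero.2 (mul_ne_zero (mul_ne_zero two_ne_zero hpi) hBne)) hq0
  set w : ℝ → ℂ := fun θ => A - (θ * B) ^ 2 / c with hw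
  set Ψ : ℝ → ℝ := fun θ => (pvGauss A (θ * B) c 0 0 / N).re with hΨ
  have hderiv : ∀ θ ∈ Set.Ioo (0 : ℝ) 1, HasDerivAt Ψ ((1 / w θ) ^ (1 / 2 : ℂ)).re θ := by
    intro θ hθ
    have h1 := (hasDerivAt_pvGauss_middle hκ h (θ := θ) ⟨by linarith [hθ.1], hθ.2⟩).div_const N
    have h2 := Complex.reCLM.hasFDerivAt.comp_hasDerivAt θ h1
    convert! h2 using 1
    simp only [Complex.reCLM_apply, hw]
    rw [← hq, ← mul_assoc, ← hN, mul_div_cancel_left₀ _ hN0]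
  have hcont : ContinuousOn Ψ (Set.Icc 0 1) :=
    Complex.continuous_re.comp_continuousOn ((continuousOn_pvGauss_middle hκ h).div_const N)
  have hwre : ∀ θ ∈ Set.Ioo (0 : ℝ) 1, 0 < (w θ).re := by
    intro θ hθ
    have hco : Coercive κ A (θ * B) c :=
      h.mul_middle (by rw [abs_of_pos hθ.1]; exact hθ.2.le)
    have hcn : 0 < ‖(c : ℂ)‖ := norm_pos_iff.2 hcC
    have h1 : 0 < ‖(c : ℂ)‖ ^ 2 * (w θ).re := lt_of_lt_of_le (by positivity) (hco.schur hκ)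
    exact pos_of_mul_pos_right h1 (by positivity)
  have hlow : ∀ θ ∈ Set.Ioo (0 : ℝ) 1,
      Real.sqrt (1 / ‖w θ‖ / 2) ≤ ((1 / w θ) ^ (1 / 2 : ℂ)).re := by
    intro θ hθ
    have h1 := hwre θ hθ
    have h2 : 0 < (1 / w θ).re := by
      rw [one_div, Complex.inv_re]
      refine div_pos h1 (Complex.normSq_pos.2 ?_)
      intro h0; rw [h0] at h1; simp at h1
    have := sqrt_half_norm_le_re_cpow_half h2
    rwa [norm_div, norm_one] at this
  set k : ℝ := 1 / (2 * Real.sqrt M * L) with hk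
  set θ₀ : ℝ := (Real.sqrt L)⁻¹ with hθ₀
  have hsL : 1 ≤ Real.sqrt L := Real.one_le_sqrt.2 hL
  have hθ0 : 0 < θ₀ := by rw [hθ₀]; positivity
  have hθ1 : θ₀ ≤ 1 := inv_le_one_of_one_le₀ hsL
  have hθsq : θ₀ ^ 2 * L = 1 := by
    rw [hθ₀, inv_pow, Real.sq_sqrt hL0.le, inv_mul_cancel₀ hL0.ne']
  -- beyond `θ₀ = L ^ (-1/2)` the cross term dominates the chirp
  have hlow2 : ∀ θ ∈ Set.Ioo θ₀ 1, k / θ ≤ ((1 / w θ) ^ (1 / 2 : ℂ)).re := by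
    intro θ hθ
    have hθp : 0 < θ := hθ0.trans hθ.1
    refine le_trans ?_ (hlow θ ⟨hθp, hθ.2⟩)
    apply Real.le_sqrt_of_sq_le
    have hwn : ‖w θ‖ ≤ 2 * M * θ ^ 2 * L ^ 2 := by
      have h1 : ‖w θ‖ ≤ ‖A‖ + θ ^ 2 * ‖B‖ ^ 2 / c := by
        refine (norm_sub_le _ _).trans (le_of_eq ?_)
        rw [norm_div, norm_pow, norm_mul, Complex.norm_real, Complex.norm_real, Real.norm_eq_abs,
          Real.norm_eq_abs, abs_of_pos hc, mul_pow, sq_abs]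
      have h2 : θ ^ 2 * ‖B‖ ^ 2 / c ≤ M * θ ^ 2 * L ^ 2 := by
        rw [div_le_iff₀ hc]
        have := mul_le_mul_of_nonneg_left hB (sq_nonneg θ)
        linarith
      have h3 : M * L ≤ M * θ ^ 2 * L ^ 2 := by
        have h4 : θ₀ ^ 2 ≤ θ ^ 2 := by gcongr; exact hθ.1.le
        have h5 : 1 ≤ θ ^ 2 * L := by
          rw [← hθsq]; gcongr
        have := mul_le_mul_of_nonneg_left h5 (mul_pos hM hL0).le
        linarith
      linarith
    have hwp : 0 < ‖w θ‖ := by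
      have := hwre θ ⟨hθp, hθ.2⟩
      exact lt_of_lt_of_le this (Complex.re_le_norm _)
    have : (k / θ) ^ 2 = 1 / (2 * M * θ ^ 2 * L ^ 2) / 2 := by
      rw [hk, div_pow, div_pow, mul_pow, mul_pow, Real.sq_sqrt hM.le]
      field_simp
    rw [this]
    gcongr
  have hmono1 : Ψ 0 ≤ Ψ θ₀ := by
    have : MonotoneOn Ψ (Set.Icc 0 θ₀) := by
      refine monotoneOn_of_deriv_nonneg (convex_Icc _ _)
        (hcont.mono (Set.Icc_subset_Icc_right hθ1)) ?_ ?_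
      · intro x hx
        rw [interior_Icc] at hx
        exact (hderiv x ⟨hx.1, hx.2.trans_le hθ1⟩).differentiableAt.differentiableWithinAt
      · intro x hx
        rw [interior_Icc] at hx
        have hx' : x ∈ Set.Ioo (0 : ℝ) 1 := ⟨hx.1, hx.2.trans_le hθ1⟩
        rw [(hderiv x hx').deriv]
        exact (Real.sqrt_nonneg _).trans (hlow x hx')
    exact this (Set.left_mem_Icc.2 hθ0.le) (Set.right_mem_Icc.2 hθ0.le) hθ0.le
  have hmono2 : Ψ θ₀ - k * Real.log θ₀ ≤ Ψ 1 - k * Real.log 1 := by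
    have : MonotoneOn (fun θ => Ψ θ - k * Real.log θ) (Set.Icc θ₀ 1) := by
      have hd : ∀ x ∈ Set.Ioo θ₀ 1, HasDerivAt (fun θ => Ψ θ - k * Real.log θ)
          (((1 / w x) ^ (1 / 2 : ℂ)).re - k * x⁻¹) x := fun x hx =>
        (hderiv x ⟨hθ0.trans hx.1, hx.2⟩).sub
          ((Real.hasDerivAt_log (hθ0.trans hx.1).ne').const_mul k)
      refine monotoneOn_of_deriv_nonneg (convex_Icc _ _) ?_ ?_ ?_
      · refine (hcont.mono (Set.Icc_subset_Icc_left hθ0.le)).sub (continuousOn_const.mul ?_)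
        exact Real.continuousOn_log.mono fun x hx => (hθ0.trans_le hx.1).ne'
      · intro x hx
        rw [interior_Icc] at hx
        exact (hd x hx).differentiableAt.differentiableWithinAt
      · intro x hx
        rw [interior_Icc] at hx
        rw [(hd x hx).deriv, ← div_eq_mul_inv]
        linarith [hlow2 x hx]
    exact this (Set.left_mem_Icc.2 hθ1) (Set.right_mem_Icc.2 hθ1) hθ1
  have hlog : Real.log θ₀ = -(Real.log L / 2) := by
    rw [hθ₀, Real.log_inv, Real.log_sqrt hL0.le]
  have hΨ0 : Ψ 0 = 0 := by simp [hΨ, pvGauss_zero_middle]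
  have hΨ1 : Ψ 1 ≤ ‖pvGauss A B c 0 0‖ / ‖N‖ := by
    rw [← norm_div]
    simp only [hΨ, Complex.ofReal_one, one_mul]
    exact Complex.re_le_norm _
  rw [Real.log_one, mul_zero, sub_zero, hlog] at hmono2
  have hfin : k * (Real.log L / 2) ≤ ‖pvGauss A B c 0 0‖ / ‖N‖ := by linarith
  have hNn : ‖N‖ = 2 * Real.pi * ‖B‖ * (Real.sqrt c)⁻¹ := by
    rw [hN, norm_mul, norm_neg, norm_mul, norm_mul, hqn, Complex.norm_real, Real.norm_eq_abs,
      abs_of_pos Real.pi_pos, Complex.norm_ofNat]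
  rw [le_div_iff₀ (norm_pos_iff.2 hN0), hNn] at hfin
  refine le_trans ?_ hfin
  have hlL : 0 ≤ Real.log L := Real.log_nonneg hL
  calc _ = k * (Real.log L / 2) * (2 * Real.pi * (m * L) * (Real.sqrt c)⁻¹) := by
        rw [hk]; field_simp
    _ ≤ _ := by gcongr

/-! ### A Gaussian regularization of the sign function -/

/-- A smooth approximation of the sign function, which converges to it pointwise as `δ → 0`. -/
noncomputable def smoothSign (δ y : ℝ) : ℝ :=
  2 / Real.pi * ∫ t in Set.Ioi (0 : ℝ),
    Real.exp (-(Real.pi * δ ^ 2) * t ^ 2) * (Real.sin (2 * Real.pi * y * t) / t)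

/-- Half of the Fourier transform of a real Gaussian. -/
lemma integral_Ioi_exp_mul_cos {δ : ℝ} (hδ : 0 < δ) (y : ℝ) :
    ∫ t in Set.Ioi (0 : ℝ), Real.exp (-(Real.pi * δ ^ 2) * t ^ 2) * Real.cos (2 * Real.pi * y * t) =
      1 / (2 * δ) * Real.exp (-Real.pi * (y / δ) ^ 2) := by
  have hb : 0 < (((Real.pi * δ ^ 2 : ℝ)) : ℂ).re := by rw [Complex.ofReal_re]; positivity
  have h1 := fourierIntegral_gaussian hb ((2 * Real.pi * y : ℝ) : ℂ)
  have hi : Integrable (fun x : ℝ => Complex.exp (Complex.I * ((2 * Real.pi * y : ℝ) : ℂ) * x) *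
      Complex.exp (-((Real.pi * δ ^ 2 : ℝ) : ℂ) * x ^ 2)) := by
    refine (integrable_cexp_quadratic hb (Complex.I * ((2 * Real.pi * y : ℝ) : ℂ)) 0).congr
      (Filter.Eventually.of_forall fun x => ?_)
    simp only [← Complex.exp_add]; congr 1; ring
  rw [← integral_Ioi_add_neg hi] at h1
  have h2 : ∀ x : ℝ, Complex.exp (Complex.I * ((2 * Real.pi * y : ℝ) : ℂ) * x) *
      Complex.exp (-((Real.pi * δ ^ 2 : ℝ) : ℂ) * x ^ 2) +
      Complex.exp (Complex.I * ((2 * Real.pi * y : ℝ) : ℂ) * ((-x : ℝ) : ℂ)) *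
      Complex.exp (-((Real.pi * δ ^ 2 : ℝ) : ℂ) * ((-x : ℝ) : ℂ) ^ 2) =
      ((2 * (Real.exp (-(Real.pi * δ ^ 2) * x ^ 2) * Real.cos (2 * Real.pi * y * x)) : ℝ) : ℂ) := by
    intro x
    push_cast
    rw [Complex.cos, neg_sq]
    ring_nf
  simp only [h2] at h1
  have h3 : ((Real.pi : ℂ) / ((Real.pi * δ ^ 2 : ℝ) : ℂ)) ^ (1 / 2 : ℂ) = ((1 / δ : ℝ) : ℂ) := by
    rw [← Complex.ofReal_div, show (1 / 2 : ℂ) = ((1 / 2 : ℝ) : ℂ) by push_cast; rfl,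
      ← Complex.ofReal_cpow (by positivity), ← Real.sqrt_eq_rpow]
    congr 1
    rw [show Real.pi / (Real.pi * δ ^ 2) = (1 / δ) ^ 2 by field_simp, Real.sqrt_sq (by positivity)]
  rw [h3, integral_complex_ofReal, show (-(((2 * Real.pi * y : ℝ) : ℂ)) ^ 2 /
    (4 * ((Real.pi * δ ^ 2 : ℝ) : ℂ))) = ((-Real.pi * (y / δ) ^ 2 : ℝ) : ℂ) by
      push_cast
      have : (Real.pi : ℂ) ≠ 0 := by exact_mod_cast Real.pi_ne_zero
      have : (δ : ℂ) ≠ 0 := by exact_mod_cast hδ.ne'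
      field_simp
      ring, ← Complex.ofReal_exp, ← Complex.ofReal_mul] at h1
  have h4 := Complex.ofReal_injective h1
  rw [integral_const_mul] at h4
  rw [show 1 / (2 * δ) * Real.exp (-Real.pi * (y / δ) ^ 2) =
    1 / δ * Real.exp (-Real.pi * (y / δ) ^ 2) / 2 by field_simp, ← h4]
  ring

lemma abs_sin_div_le (a t : ℝ) : |Real.sin (a * t) / t| ≤ |a| := by
  rcases eq_or_ne t 0 with rfl | ht
  · simp
  · rw [abs_div, div_le_iff₀ (abs_pos.2 ht), ← abs_mul]
    exact Real.abs_sin_le_abs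

lemma integrable_exp_mul_sin_div {δ : ℝ} (hδ : 0 < δ) (y : ℝ) :
    Integrable (fun t => Real.exp (-(Real.pi * δ ^ 2) * t ^ 2) *
      (Real.sin (2 * Real.pi * y * t) / t)) := by
  refine ((integrable_exp_neg_mul_sq (b := Real.pi * δ ^ 2) (by positivity)).mul_const
    |2 * Real.pi * y|).mono' (Measurable.aestronglyMeasurable (by fun_prop))
    (Filter.Eventually.of_forall fun t => ?_)
  rw [norm_mul, Real.norm_eq_abs, Real.norm_eq_abs, Real.abs_exp]
  exact mul_le_mul_of_nonneg_left (abs_sin_div_le _ _) (Real.exp_pos _).le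

lemma hasDerivAt_smoothSign {δ : ℝ} (hδ : 0 < δ) (y : ℝ) :
    HasDerivAt (smoothSign δ) (2 / δ * Real.exp (-Real.pi * (y / δ) ^ 2)) y := by
  have hc : 0 < Real.pi * δ ^ 2 := by positivity
  have := (hasDerivAt_integral_of_dominated_loc_of_deriv_le
    (μ := volume.restrict (Set.Ioi (0 : ℝ)))
    (F := fun y t => Real.exp (-(Real.pi * δ ^ 2) * t ^ 2) * (Real.sin (2 * Real.pi * y * t) / t))
    (F' := fun y t => 2 * Real.pi * (Real.exp (-(Real.pi * δ ^ 2) * t ^ 2) *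
      Real.cos (2 * Real.pi * y * t)))
    (bound := fun t => 2 * Real.pi * (Real.exp (-(Real.pi * δ ^ 2) * t ^ 2)))
    (Filter.univ_mem : Set.univ ∈ nhds y)
    (Filter.Eventually.of_forall fun x => (integrable_exp_mul_sin_div hδ x).1.restrict)
    (integrable_exp_mul_sin_div hδ y).integrableOn
    (Continuous.aestronglyMeasurable (by fun_prop)) ?_
    ((integrable_exp_neg_mul_sq hc).integrableOn.const_mul _) ?_).2
  · convert! this.const_mul (2 / Real.pi) using 1
    rw [integral_const_mul, integral_Ioi_exp_mul_cos hδ]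
    field_simp
  · refine Filter.Eventually.of_forall fun t x _ => ?_
    rw [Real.norm_eq_abs, abs_mul, abs_mul (Real.exp _), Real.abs_exp,
      abs_of_pos (by positivity : 0 < 2 * Real.pi)]
    have := Real.abs_cos_le_one (2 * Real.pi * x * t)
    gcongr
    exact mul_le_of_le_one_right (Real.exp_pos _).le this
  · refine (ae_restrict_iff' measurableSet_Ioi).2 (Filter.Eventually.of_forall
      fun t (ht : 0 < t) x _ => ?_)
    have h1 : HasDerivAt (fun x => 2 * Real.pi * x * t) (2 * Real.pi * t) x := by
      simpa using ((hasDerivAt_id x).const_mul (2 * Real.pi)).mul_const t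
    convert! ((h1.sin.div_const t).const_mul (Real.exp (-(Real.pi * δ ^ 2) * t ^ 2))) using 1
    field_simp

lemma smoothSign_eq {δ : ℝ} (hδ : 0 < δ) (y : ℝ) :
    smoothSign δ y = 2 * ∫ z in (0 : ℝ)..(y / δ), Real.exp (-Real.pi * z ^ 2) := by
  have h0 : smoothSign δ 0 = 0 := by simp [smoothSign]
  have h1 := intervalIntegral.integral_eq_sub_of_hasDerivAt (a := 0) (b := y)
    (fun x _ => hasDerivAt_smoothSign hδ x)
    (Continuous.intervalIntegrable (by fun_prop) _ _)
  rw [h0, sub_zero] at h1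
  rw [← h1, intervalIntegral.integral_const_mul,
    intervalIntegral.integral_comp_div (fun z => Real.exp (-Real.pi * z ^ 2)) hδ.ne']
  simp only [zero_div, smul_eq_mul]
  field_simp

lemma abs_smoothSign_le {δ : ℝ} (hδ : 0 < δ) (y : ℝ) : |smoothSign δ y| ≤ 2 := by
  rw [smoothSign_eq hδ, abs_mul, abs_two]
  have hi := integrable_exp_neg_mul_sq Real.pi_pos
  have h1 : |∫ z in (0 : ℝ)..(y / δ), Real.exp (-Real.pi * z ^ 2)| ≤
      ∫ z, Real.exp (-Real.pi * z ^ 2) := by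
    have h2 := intervalIntegral.norm_integral_le_integral_norm_uIoc (μ := volume) (a := 0)
      (b := y / δ) (f := fun z => Real.exp (-Real.pi * z ^ 2))
    refine le_trans h2 ?_
    simp only [Real.norm_eq_abs, Real.abs_exp]
    exact setIntegral_le_integral hi (Filter.Eventually.of_forall fun z => (Real.exp_pos _).le)
  rw [integral_gaussian, div_self Real.pi_ne_zero, Real.sqrt_one] at h1
  linarith

open Filter Topology in
lemma tendsto_smoothSign (y : ℝ) :
    Tendsto (fun δ => smoothSign δ y) (𝓝[>] 0) (𝓝 (Real.sign y)) := by
  have hi := integrable_exp_neg_mul_sq Real.pi_pos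
  have hinf : ∀ y : ℝ, 0 < y →
      Tendsto (fun δ => 2 * ∫ z in (0 : ℝ)..(y / δ), Real.exp (-Real.pi * z ^ 2))
        (𝓝[>] 0) (𝓝 1) := by
    intro y hy
    have h1 : Tendsto (fun δ : ℝ => y / δ) (𝓝[>] 0) atTop := by
      simpa [div_eq_mul_inv] using tendsto_inv_nhdsGT_zero.const_mul_atTop hy
    have h2 := ((intervalIntegral_tendsto_integral_Ioi 0 hi.integrableOn tendsto_id).comp h1).const_mul 2
    rw [integral_gaussian_Ioi, div_self Real.pi_ne_zero, Real.sqrt_one] at h2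
    simpa using h2
  have hev : ∀ᶠ δ in 𝓝[>] (0 : ℝ), 2 * (∫ z in (0 : ℝ)..(y / δ), Real.exp (-Real.pi * z ^ 2)) =
      smoothSign δ y := by
    filter_upwards [self_mem_nhdsWithin] with δ hδ
    rw [smoothSign_eq hδ]
  refine Tendsto.congr' hev ?_
  rcases lt_trichotomy y 0 with hy | rfl | hy
  · rw [Real.sign_of_neg hy]
    refine (hinf (-y) (by linarith)).neg.congr fun δ => ?_
    have := intervalIntegral.integral_comp_neg (a := 0) (b := y / δ)
      (fun z => Real.exp (-Real.pi * z ^ 2))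
    simp only [neg_sq, neg_zero] at this
    rw [neg_div, this, intervalIntegral.integral_symm]
    ring
  · simp
  · rw [Real.sign_of_pos hy]
    exact hinf y hy

lemma continuous_smoothSign {δ : ℝ} (hδ : 0 < δ) : Continuous (smoothSign δ) :=
  continuous_iff_continuousAt.2 fun y => (hasDerivAt_smoothSign hδ y).continuousAt

/-! ### The double Hilbert kernel in physical space -/

section Kernel

variable {X : Type*} [MeasurableSpace X] {μ : Measure X}

/-- The transform `∫ g(ξ) exp (2πi (a(ξ) t + b(ξ) s)) dμ(ξ)` in two variables. -/
noncomputable def jointFourier (μ : Measure X) (g : X → ℂ) (a b : X → ℝ) (t s : ℝ) : ℂ :=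
  ∫ ξ, g ξ * Complex.exp (2 * Real.pi * Complex.I * (a ξ * t + b ξ * s)) ∂μ

lemma integrable_mul_exp_two_pi_I {g : X → ℂ} {a b : X → ℝ} (hg : Integrable g μ)
    (ha : Measurable a) (hb : Measurable b) (t s : ℝ) :
    Integrable (fun ξ => g ξ * Complex.exp (2 * Real.pi * Complex.I * (a ξ * t + b ξ * s))) μ := by
  refine hg.mul_bdd (c := 1) (Measurable.aestronglyMeasurable (by fun_prop))
    (Filter.Eventually.of_forall fun ξ => ?_)
  rw [show (2 * Real.pi * Complex.I * (a ξ * t + b ξ * s) : ℂ) =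
    ((2 * Real.pi * (a ξ * t + b ξ * s) : ℝ) : ℂ) * Complex.I by push_cast; ring,
    Complex.norm_exp_ofReal_mul_I]

/-- The product of two sines extracts the part of the transform that is odd in each variable. -/
lemma integral_mul_sin_mul_sin {g : X → ℂ} {a b : X → ℝ} (hg : Integrable g μ)
    (ha : Measurable a) (hb : Measurable b) (t s : ℝ) :
    ∫ ξ, g ξ * (Real.sin (2 * Real.pi * a ξ * t) : ℂ) * (Real.sin (2 * Real.pi * b ξ * s) : ℂ) ∂μ =
      -(1 / 4) * altSum (jointFourier μ g a b) t s := by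
  set e : ℝ → ℝ → X → ℂ := fun t s ξ =>
    g ξ * Complex.exp (2 * Real.pi * Complex.I * (a ξ * t + b ξ * s)) with he
  have i : ∀ t s, Integrable (e t s) μ := integrable_mul_exp_two_pi_I hg ha hb
  have hj : ∀ t s, jointFourier μ g a b t s = ∫ ξ, e t s ξ ∂μ := fun t s => rfl
  have i1 : Integrable (fun ξ => e t s ξ - e (-t) s ξ) μ := (i _ _).sub (i _ _)
  have i2 : Integrable (fun ξ => e t s ξ - e (-t) s ξ - e t (-s) ξ) μ := i1.sub (i _ _)
  rw [altSum, hj, hj, hj, hj, ← integral_sub (i t s) (i (-t) s), ← integral_sub i1 (i t (-s)),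
    ← integral_add i2 (i (-t) (-s)), ← integral_const_mul]
  refine integral_congr_ae (Filter.Eventually.of_forall fun ξ => ?_)
  simp only [he]
  push_cast
  have e1 : Complex.exp (2 * Real.pi * Complex.I * (a ξ * t + b ξ * s)) =
    Complex.exp (2 * Real.pi * a ξ * t * Complex.I) *
      Complex.exp (2 * Real.pi * b ξ * s * Complex.I) := by rw [← Complex.exp_add]; ring_nf
  have e2 : Complex.exp (2 * Real.pi * Complex.I * (a ξ * (-t) + b ξ * s)) =
    Complex.exp (-(2 * Real.pi * a ξ * t) * Complex.I) *
      Complex.exp (2 * Real.pi * b ξ * s * Complex.I) := by rw [← Complex.exp_add]; ring_nf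
  have e3 : Complex.exp (2 * Real.pi * Complex.I * (a ξ * t + b ξ * (-s))) =
    Complex.exp (2 * Real.pi * a ξ * t * Complex.I) *
      Complex.exp (-(2 * Real.pi * b ξ * s) * Complex.I) := by rw [← Complex.exp_add]; ring_nf
  have e4 : Complex.exp (2 * Real.pi * Complex.I * (a ξ * (-t) + b ξ * (-s))) =
    Complex.exp (-(2 * Real.pi * a ξ * t) * Complex.I) *
      Complex.exp (-(2 * Real.pi * b ξ * s) * Complex.I) := by rw [← Complex.exp_add]; ring_nf
  rw [e1, e2, e3, e4, Complex.sin, Complex.sin]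
  linear_combination (-(1 / 4) * g ξ * (Complex.exp (2 * Real.pi * a ξ * t * Complex.I) -
    Complex.exp (-(2 * Real.pi * a ξ * t) * Complex.I)) *
    (Complex.exp (2 * Real.pi * b ξ * s * Complex.I) -
    Complex.exp (-(2 * Real.pi * b ξ * s) * Complex.I)) * (-1)) * Complex.I_sq

/-- Integration against two regularized signs is a double principal value integral. -/
lemma integral_mul_smoothSign_mul_smoothSign [SFinite μ] {δ : ℝ} (hδ : 0 < δ) {g : X → ℂ} {a b : X → ℝ}
    (hg : Integrable g μ) (ha : Measurable a) (hb : Measurable b)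
    (hgab : Integrable (fun ξ => ‖g ξ‖ * (|a ξ| * |b ξ|)) μ) :
    ∫ ξ, g ξ * (smoothSign δ (a ξ) : ℂ) * (smoothSign δ (b ξ) : ℂ) ∂μ =
      -(1 / Real.pi ^ 2) * ∫ p in quadrant, (Real.exp (-(Real.pi * δ ^ 2) * (p.1 ^ 2 + p.2 ^ 2)) : ℂ) *
        (altSum (jointFourier μ g a b) p.1 p.2 / (p.1 * p.2)) := by
  set K : ℝ → ℝ → ℝ := fun y t => Real.exp (-(Real.pi * δ ^ 2) * t ^ 2) *
    (Real.sin (2 * Real.pi * y * t) / t) with hK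
  have hc : 0 < Real.pi * δ ^ 2 := by positivity
  have hKm : Measurable (fun q : ℝ × ℝ => K q.1 q.2) := by rw [hK]; fun_prop
  set F : X → ℝ × ℝ → ℂ := fun ξ p => g ξ * ((K (a ξ) p.1 * K (b ξ) p.2 : ℝ) : ℂ) with hF
  have hFint : Integrable (Function.uncurry F) (μ.prod (volume.restrict quadrant)) := by
    have he : Integrable (fun p : ℝ × ℝ => Real.exp (-(Real.pi * δ ^ 2) * p.1 ^ 2) *
        Real.exp (-(Real.pi * δ ^ 2) * p.2 ^ 2)) :=
      (integrable_exp_neg_mul_sq hc).mul_prod (integrable_exp_neg_mul_sq hc)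
    have hdom := (hgab.mul_prod (he.restrict (s := quadrant))).const_mul (4 * Real.pi ^ 2)
    refine hdom.mono' ?_ (Filter.Eventually.of_forall fun q => ?_)
    · refine hg.aestronglyMeasurable.comp_fst.mul (Measurable.aestronglyMeasurable ?_)
      refine Complex.measurable_ofReal.comp (Measurable.mul ?_ ?_)
      · exact hKm.comp (f := fun q : X × (ℝ × ℝ) => (a q.1, q.2.1)) (by fun_prop)
      · exact hKm.comp (f := fun q : X × (ℝ × ℝ) => (b q.1, q.2.2)) (by fun_prop)
    · have hKb : ∀ y t, |K y t| ≤ Real.exp (-(Real.pi * δ ^ 2) * t ^ 2) * (2 * Real.pi * |y|) := by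
        intro y t
        rw [hK]; dsimp only
        rw [abs_mul, Real.abs_exp]
        refine mul_le_mul_of_nonneg_left ((abs_sin_div_le _ _).trans (le_of_eq ?_))
          (Real.exp_pos _).le
        rw [abs_mul, abs_of_pos (by positivity : 0 < 2 * Real.pi)]
      simp only [Function.uncurry, hF]
      rw [norm_mul, Complex.norm_real, Real.norm_eq_abs, abs_mul]
      calc _ ≤ ‖g q.1‖ * ((Real.exp (-(Real.pi * δ ^ 2) * q.2.1 ^ 2) * (2 * Real.pi * |a q.1|)) *
            (Real.exp (-(Real.pi * δ ^ 2) * q.2.2 ^ 2) * (2 * Real.pi * |b q.1|))) := by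
            gcongr
            · exact hKb _ _
            · exact hKb _ _
        _ = _ := by ring
  have h1 : ∀ ξ, g ξ * (smoothSign δ (a ξ) : ℂ) * (smoothSign δ (b ξ) : ℂ) =
      (4 / Real.pi ^ 2 : ℂ) * ∫ p in quadrant, F ξ p := by
    intro ξ
    simp only [hF]
    rw [integral_const_mul, integral_complex_ofReal, Measure.volume_eq_prod,
      setIntegral_prod_mul (K (a ξ)) (K (b ξ)), smoothSign, smoothSign]
    push_cast
    ring
  simp only [h1]
  rw [integral_const_mul, integral_integral_swap hFint, ← integral_const_mul,
    ← integral_const_mul]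
  refine setIntegral_congr_fun measurableSet_quadrant fun p hp => ?_
  have hp1 : (p.1 : ℂ) ≠ 0 := by exact_mod_cast (show 0 < p.1 from hp.1).ne'
  have hp2 : (p.2 : ℂ) ≠ 0 := by exact_mod_cast (show 0 < p.2 from hp.2).ne'
  have hpi : (Real.pi : ℂ) ≠ 0 := by exact_mod_cast Real.pi_ne_zero
  have h2 : ∫ ξ, F ξ p ∂μ = (Real.exp (-(Real.pi * δ ^ 2) * (p.1 ^ 2 + p.2 ^ 2)) : ℂ) /
      (p.1 * p.2) * (-(1 / 4) * altSum (jointFourier μ g a b) p.1 p.2) := by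
    rw [← integral_mul_sin_mul_sin hg ha hb, ← integral_const_mul]
    refine integral_congr_ae (Filter.Eventually.of_forall fun ξ => ?_)
    simp only [hF, hK]
    rw [mul_add, Real.exp_add]
    push_cast
    field_simp
  simp only [h2]
  field_simp

open Filter Topology in
lemma tendsto_integral_mul_smoothSign {g : X → ℂ} {a b : X → ℝ}
    (hg : Integrable g μ) (ha : Measurable a) (hb : Measurable b) :
    Tendsto (fun δ => ∫ ξ, g ξ * (smoothSign δ (a ξ) : ℂ) * (smoothSign δ (b ξ) : ℂ) ∂μ)
      (𝓝[>] 0) (𝓝 (∫ ξ, g ξ * (Real.sign (a ξ) : ℂ) * (Real.sign (b ξ) : ℂ) ∂μ)) := by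
  refine tendsto_integral_filter_of_dominated_convergence (fun ξ => ‖g ξ‖ * 2 * 2) ?_ ?_
    ((hg.norm.mul_const 2).mul_const 2) ?_
  · filter_upwards [self_mem_nhdsWithin] with δ hδ
    have hm := (continuous_smoothSign (Set.mem_Ioi.1 hδ)).measurable
    exact (hg.1.mul (Complex.measurable_ofReal.comp (hm.comp ha)).aestronglyMeasurable).mul
      (Complex.measurable_ofReal.comp (hm.comp hb)).aestronglyMeasurable
  · filter_upwards [self_mem_nhdsWithin] with δ hδ
    refine Eventually.of_forall fun ξ => ?_
    rw [norm_mul, norm_mul, Complex.norm_real, Complex.norm_real]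
    gcongr
    · exact abs_smoothSign_le hδ _
    · exact abs_smoothSign_le hδ _
  · refine Eventually.of_forall fun ξ => ?_
    have h := fun y : ℝ => (Complex.continuous_ofReal.tendsto _).comp (tendsto_smoothSign y)
    exact (tendsto_const_nhds.mul (h _)).mul (h _)

end Kernel

/-! ### Modulated Gaussian chirps -/

/-- The function `exp (-π z x² + 2πi c x)`. -/
noncomputable def chirpFun (z : ℂ) (c x : ℝ) : ℂ :=
  Complex.exp (-Real.pi * z * x ^ 2 + 2 * Real.pi * (Complex.I * c) * x)

lemma contDiff_chirpFun (z : ℂ) (c : ℝ) : ContDiff ℝ ⊤ (chirpFun z c) := by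
  have h : ContDiff ℝ ⊤ (fun x : ℝ => (x : ℂ)) := Complex.ofRealCLM.contDiff
  unfold chirpFun
  exact ((contDiff_const.mul (h.pow 2)).add (contDiff_const.mul h)).cexp

lemma hasDerivAt_chirpFun (z : ℂ) (c x : ℝ) :
    HasDerivAt (chirpFun z c)
      ((-2 * Real.pi * z * x + 2 * Real.pi * (Complex.I * c)) * chirpFun z c x) x := by
  unfold chirpFun
  have h0 : HasDerivAt (fun x : ℝ => (x : ℂ)) 1 x := Complex.ofRealCLM.hasDerivAt
  convert! (((h0.pow 2).const_mul (-Real.pi * z : ℂ)).add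
    (h0.const_mul (2 * Real.pi * (Complex.I * c)))).cexp using 1
  simp
  ring

/-- Every derivative of a chirp is a polynomial multiple of it. -/
lemma exists_iteratedDeriv_chirpFun (z : ℂ) (c : ℝ) (n : ℕ) :
    ∃ p : Polynomial ℂ, iteratedDeriv n (chirpFun z c) =
      fun x : ℝ => p.eval (x : ℂ) * chirpFun z c x := by
  induction n with
  | zero => exact ⟨1, by simp⟩
  | succ n ih =>
    obtain ⟨p, hp⟩ := ih
    refine ⟨Polynomial.derivative p + p * (Polynomial.C (-2 * Real.pi * z) * Polynomial.X +
      Polynomial.C (2 * Real.pi * (Complex.I * c))), ?_⟩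
    rw [iteratedDeriv_succ, hp]
    ext x
    have h := ((p.hasDerivAt (x : ℂ)).comp_ofReal.mul (hasDerivAt_chirpFun z c x)).deriv
    refine h.trans ?_
    simp
    ring

lemma norm_chirpFun (z : ℂ) (c x : ℝ) :
    ‖chirpFun z c x‖ = Real.exp (-Real.pi * z.re * x ^ 2) := by
  rw [chirpFun, Complex.norm_exp]
  congr 1
  rw [show (-Real.pi * z * x ^ 2 + 2 * Real.pi * (Complex.I * c) * x : ℂ) =
    ((-Real.pi * x ^ 2 : ℝ) : ℂ) * z + ((2 * Real.pi * c * x : ℝ) : ℂ) * Complex.I by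
      push_cast; ring, Complex.add_re, Complex.re_ofReal_mul, Complex.re_ofReal_mul, Complex.I_re]
  ring

lemma abs_pow_mul_exp_neg_le {a : ℝ} (ha : 0 < a) (m : ℕ) (x : ℝ) :
    |x| ^ m * Real.exp (-a * x ^ 2) ≤ 1 + m.factorial / a ^ m := by
  have h1 : |x| ^ m ≤ 1 + (x ^ 2) ^ m := by
    rw [← sq_abs, ← pow_mul, mul_comm, pow_mul]
    nlinarith [sq_nonneg (|x| ^ m - 1), pow_nonneg (abs_nonneg x) m]
  have h2 := Real.pow_div_factorial_le_exp (x := a * x ^ 2) (by positivity) m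
  have h3 : (x ^ 2) ^ m ≤ m.factorial / a ^ m * Real.exp (a * x ^ 2) := by
    rw [mul_pow, div_le_iff₀ (by positivity)] at h2
    rw [div_mul_eq_mul_div, le_div_iff₀ (by positivity)]
    linarith
  have h4 : Real.exp (-a * x ^ 2) ≤ 1 := Real.exp_le_one_iff.2 (by nlinarith [sq_nonneg x])
  have h5 : Real.exp (a * x ^ 2) * Real.exp (-a * x ^ 2) = 1 := by
    rw [← Real.exp_add]; simp
  calc _ ≤ (1 + m.factorial / a ^ m * Real.exp (a * x ^ 2)) * Real.exp (-a * x ^ 2) := by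
        gcongr; linarith
    _ = Real.exp (-a * x ^ 2) + m.factorial / a ^ m *
        (Real.exp (a * x ^ 2) * Real.exp (-a * x ^ 2)) := by ring
    _ ≤ _ := by rw [h5, mul_one]; gcongr

lemma chirpFun_decay {z : ℂ} (hz : 0 < z.re) (c : ℝ) (k n : ℕ) :
    ∃ C : ℝ, ∀ x : ℝ, ‖x‖ ^ k * ‖iteratedFDeriv ℝ n (chirpFun z c) x‖ ≤ C := by
  obtain ⟨p, hp⟩ := exists_iteratedDeriv_chirpFun z c n
  have ha : 0 < Real.pi * z.re := mul_pos Real.pi_pos hz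
  refine ⟨∑ i ∈ p.support, ‖p.coeff i‖ *
    (1 + (k + i).factorial / (Real.pi * z.re) ^ (k + i)), fun x => ?_⟩
  rw [norm_iteratedFDeriv_eq_norm_iteratedDeriv, hp, norm_mul, norm_chirpFun, Polynomial.eval_eq_sum,
    Polynomial.sum, Real.norm_eq_abs]
  calc _ ≤ |x| ^ k * ((∑ i ∈ p.support, ‖p.coeff i‖ * |x| ^ i) *
        Real.exp (-Real.pi * z.re * x ^ 2)) := by
        gcongr
        refine (norm_sum_le _ _).trans (Finset.sum_le_sum fun i _ => ?_)
        rw [norm_mul, norm_pow, Complex.norm_real, Real.norm_eq_abs]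
    _ = ∑ i ∈ p.support, ‖p.coeff i‖ *
        (|x| ^ (k + i) * Real.exp (-(Real.pi * z.re) * x ^ 2)) := by
        rw [Finset.sum_mul, Finset.mul_sum]
        refine Finset.sum_congr rfl fun i _ => ?_
        rw [pow_add]; ring_nf
    _ ≤ _ := by
        gcongr
        exact abs_pow_mul_exp_neg_le ha _ _

/-- The Schwartz function `exp (-π z x² + 2πi c x)`, for `0 < Re z`. -/
noncomputable def chirp (z : ℂ) (hz : 0 < z.re) (c : ℝ) : 𝓢(ℝ, ℂ) where
  toFun := chirpFun z c
  smooth' := (contDiff_chirpFun z c).of_le le_top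
  decay' := chirpFun_decay hz c

lemma chirp_apply (z : ℂ) (hz : 0 < z.re) (c x : ℝ) : chirp z hz c x = chirpFun z c x := rfl

/-- Modulation by `c` translates the Fourier transform by `c`. -/
lemma fourier_chirp (z : ℂ) (hz : 0 < z.re) (c ξ : ℝ) :
    𝓕 (chirp z hz c : ℝ → ℂ) ξ = 𝓕 (chirp z hz 0 : ℝ → ℂ) (ξ - c) := by
  have h : ∀ c : ℝ, (chirp z hz c : ℝ → ℂ) =
    fun x : ℝ => Complex.exp (-Real.pi * z * x ^ 2 + 2 * Real.pi * (Complex.I * c) * x) :=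
      fun c => rfl
  rw [h, h, fourier_gaussian_pi' hz, fourier_gaussian_pi' hz]
  simp only
  congr 3
  push_cast
  linear_combination (2 * ξ * c + Complex.I ^ 2 * c ^ 2 - c ^ 2) * Complex.I_sq

lemma eLpNorm_chirp (z : ℂ) (hz : 0 < z.re) (hz1 : z.re = 1) (c : ℝ) (p : ℝ≥0∞) :
    eLpNorm (chirp z hz c : ℝ → ℂ) p volume =
      eLpNorm (chirp 1 (by simp) 0 : ℝ → ℂ) p volume := by
  refine eLpNorm_congr_norm_ae (Filter.Eventually.of_forall fun x => ?_)
  rw [chirp_apply, chirp_apply, norm_chirpFun, norm_chirpFun, hz1, Complex.one_re]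

/-! ### Fourier inversion for products -/

section Product

variable {ι : Type*} [Fintype ι]

/-- The product of the Fourier transforms, times the character evaluated at `x`. -/
noncomputable def freqProd (f : ι → 𝓢(ℝ, ℂ)) (x : ℝ) (ξ : ι → ℝ) : ℂ :=
  (∏ i, 𝓕 (f i : ℝ → ℂ) (ξ i)) * Complex.exp (2 * Real.pi * Complex.I * x * ∑ i, (ξ i : ℂ))

lemma norm_freqProd (f : ι → 𝓢(ℝ, ℂ)) (x : ℝ) (ξ : ι → ℝ) :
    ‖freqProd f x ξ‖ = ∏ i, ‖𝓕 (f i : ℝ → ℂ) (ξ i)‖ := by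
  rw [freqProd, norm_mul, show (2 * Real.pi * Complex.I * x * ∑ i, (ξ i : ℂ)) =
    ((2 * Real.pi * x * ∑ i, ξ i : ℝ) : ℂ) * Complex.I by push_cast; ring,
    Complex.norm_exp_ofReal_mul_I, mul_one, norm_prod]

lemma continuous_fourier_schwartz (f : 𝓢(ℝ, ℂ)) : Continuous (𝓕 (f : ℝ → ℂ)) := by
  rw [← SchwartzMap.fourier_coe]; exact (𝓕 f).continuous

lemma continuous_freqProd (f : ι → 𝓢(ℝ, ℂ)) :
    Continuous (fun q : ℝ × (ι → ℝ) => freqProd f q.1 q.2) := by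
  unfold freqProd
  have := fun i => continuous_fourier_schwartz (f i)
  refine (continuous_finsetProd _ fun i _ => (this i).comp (by fun_prop)).mul (by fun_prop)

lemma integrable_freqProd (f : ι → 𝓢(ℝ, ℂ)) (x : ℝ) : Integrable (freqProd f x) := by
  have h : Integrable (fun ξ : ι → ℝ => ∏ i, ‖𝓕 (f i : ℝ → ℂ) (ξ i)‖) := by
    refine Integrable.fintype_prod (f := fun i t => ‖𝓕 (f i : ℝ → ℂ) t‖) fun i => ?_
    rw [← SchwartzMap.fourier_coe]
    exact (SchwartzMap.integrable (𝓕 (f i))).norm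
  exact h.mono' ((continuous_freqProd f).comp (by fun_prop : Continuous fun ξ => (x, ξ))
    ).aestronglyMeasurable (Filter.Eventually.of_forall fun ξ => (norm_freqProd f x ξ).le)

/-- The linear form `ξ ↦ ∑ uᵢ ξᵢ`. -/
def linForm (u ξ : ι → ℝ) : ℝ := ∑ i, u i * ξ i

lemma abs_linForm_le (u ξ : ι → ℝ) : |linForm u ξ| ≤ (∑ i, |u i|) * ∏ i, (1 + |ξ i|) := by
  rw [linForm, Finset.sum_mul]
  refine (Finset.abs_sum_le_sum_abs _ _).trans (Finset.sum_le_sum fun i _ => ?_)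
  rw [abs_mul]
  gcongr
  have h1 : 1 + |ξ i| ≤ ∏ j, (1 + |ξ j|) := by
    classical
    rw [← Finset.mul_prod_erase _ _ (Finset.mem_univ i)]
    exact le_mul_of_one_le_right (by positivity)
      (Finset.one_le_prod fun j _ => by simp)
  linarith

lemma integrable_norm_freqProd_mul (f : ι → 𝓢(ℝ, ℂ)) (x : ℝ) (u v : ι → ℝ) :
    Integrable (fun ξ => ‖freqProd f x ξ‖ * (|linForm u ξ| * |linForm v ξ|)) := by
  have h : Integrable (fun ξ : ι → ℝ => ∏ i, (‖𝓕 (f i : ℝ → ℂ) (ξ i)‖ * (1 + |ξ i|) ^ 2)) := by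
    refine Integrable.fintype_prod (f := fun i t => ‖𝓕 (f i : ℝ → ℂ) t‖ * (1 + |t|) ^ 2)
      fun i => ?_
    rw [← SchwartzMap.fourier_coe]
    have h0 := (𝓕 (f i)).integrable_pow_mul volume 0
    have h1 := (𝓕 (f i)).integrable_pow_mul volume 1
    have h2 := (𝓕 (f i)).integrable_pow_mul volume 2
    refine ((h0.add (h1.const_mul 2)).add h2).congr (Filter.Eventually.of_forall fun t => ?_)
    simp only [Pi.add_apply, Real.norm_eq_abs]
    ring
  refine (h.const_mul ((∑ i, |u i|) * ∑ i, |v i|)).mono' ?_ (Filter.Eventually.of_forall fun ξ => ?_)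
  · refine Continuous.aestronglyMeasurable ?_
    have := (continuous_freqProd f).comp (by fun_prop : Continuous fun ξ : ι → ℝ => (x, ξ))
    unfold linForm
    exact this.norm.mul (by fun_prop)
  · rw [norm_mul, norm_mul, norm_norm, norm_freqProd, Finset.prod_mul_distrib, Finset.prod_pow]
    simp only [Real.norm_eq_abs, abs_abs]
    have h1 := abs_linForm_le u ξ
    have h2 := abs_linForm_le v ξ
    calc _ ≤ (∏ i, ‖𝓕 (f i : ℝ → ℂ) (ξ i)‖) * (((∑ i, |u i|) * ∏ i, (1 + |ξ i|)) *
          ((∑ i, |v i|) * ∏ i, (1 + |ξ i|))) := by gcongr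
      _ = _ := by ring

/-- By Fourier inversion in each variable, the kernel representation of the operator acts on
`∏ fᵢ(x + uᵢ t + vᵢ s)`. -/
lemma jointFourier_freqProd (f : ι → 𝓢(ℝ, ℂ)) (x : ℝ) (u v : ι → ℝ) (t s : ℝ) :
    jointFourier volume (freqProd f x) (linForm u) (linForm v) t s =
      ∏ i, f i (x + u i * t + v i * s) := by
  have inv : ∀ i (y : ℝ), f i y =
      ∫ ξ : ℝ, 𝓕 (f i : ℝ → ℂ) ξ * Complex.exp (2 * Real.pi * Complex.I * (ξ * y)) := by
    intro i y
    have h1 : 𝓕⁻ (𝓕 (f i : ℝ → ℂ)) = f i :=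
      (f i).continuous.fourierInv_fourier_eq (f i).integrable
        (by rw [← SchwartzMap.fourier_coe]; exact (𝓕 (f i)).integrable)
    conv_lhs => rw [← h1]
    rw [Real.fourierInv_eq']
    refine integral_congr_ae (Filter.Eventually.of_forall fun ξ => ?_)
    simp only [smul_eq_mul, RCLike.inner_apply, conj_trivial]
    rw [mul_comm]
    congr 2
    push_cast; ring
  simp only [inv]
  rw [← integral_fintype_prod_volume_eq_prod (fun i ξ => 𝓕 (f i : ℝ → ℂ) ξ *
    Complex.exp (2 * Real.pi * Complex.I * (ξ * ((x + u i * t + v i * s : ℝ) : ℂ))))]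
  refine integral_congr_ae (Filter.Eventually.of_forall fun ξ => ?_)
  simp only [freqProd, linForm]
  rw [Finset.prod_mul_distrib, mul_assoc, ← Complex.exp_add, ← Complex.exp_sum]
  congr 2
  push_cast
  simp only [Finset.sum_mul, Finset.mul_sum, ← Finset.sum_add_distrib]
  refine Finset.sum_congr rfl fun i _ => ?_
  ring

end Product

/-! ### Logarithmic growth of the operator with two signs -/

section Growth

variable {ι : Type*} [Fintype ι]

/-- The multilinear operator with symbol `sgn (u · ξ) sgn (v · ξ)`. -/
noncomputable def doubleSign (u v : ι → ℝ) (f : ι → 𝓢(ℝ, ℂ)) (x : ℝ) : ℂ :=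
  ∫ ξ, freqProd f x ξ * (Real.sign (linForm u ξ) : ℂ) * (Real.sign (linForm v ξ) : ℂ)

lemma measurable_linForm (u : ι → ℝ) : Measurable (linForm u) := by unfold linForm; fun_prop

lemma prod_chirp_eq (z : ι → ℂ) (hz : ∀ i, 0 < (z i).re) (u v : ι → ℝ) (x t s : ℝ) :
    ∏ i, chirp (z i) (hz i) 0 (x + u i * t + v i * s) =
      Complex.exp (-Real.pi * x ^ 2 * ∑ i, z i) *
        gauss (∑ i, z i * u i ^ 2) (∑ i, z i * (u i * v i)) (∑ i, z i * v i ^ 2)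
          (x * ∑ i, z i * u i) (x * ∑ i, z i * v i) t s := by
  simp only [chirp_apply, chirpFun, gauss]
  rw [← Complex.exp_sum, ← Complex.exp_add]
  congr 1
  simp only [Finset.mul_sum, Finset.sum_mul, ← Finset.sum_add_distrib, ← Finset.sum_neg_distrib]
  refine Finset.sum_congr rfl fun i _ => ?_
  push_cast
  ring

lemma exp_mul_gauss (A B C D E : ℂ) (δ t s : ℝ) :
    (Real.exp (-(Real.pi * δ ^ 2) * (t ^ 2 + s ^ 2)) : ℂ) * gauss A B C D E t s =
      gauss (A + δ ^ 2) B (C + δ ^ 2) D E t s := by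
  unfold gauss
  push_cast
  rw [← Complex.exp_add]
  congr 1
  ring

/-- On chirps, the operator with regularized signs is an explicit `pvGauss`; the regularization
adds `δ²` to the two diagonal coefficients. -/
lemma integral_smoothSign_chirp (z : ι → ℂ) (hz : ∀ i, 0 < (z i).re) (u v : ι → ℝ) (x : ℝ)
    {δ : ℝ} (hδ : 0 < δ) :
    ∫ ξ, freqProd (fun i => chirp (z i) (hz i) 0) x ξ * (smoothSign δ (linForm u ξ) : ℂ) *
      (smoothSign δ (linForm v ξ) : ℂ) =
      -(1 / Real.pi ^ 2) * (Complex.exp (-Real.pi * x ^ 2 * ∑ i, z i) *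
        pvGauss (∑ i, z i * u i ^ 2 + δ ^ 2) (∑ i, z i * (u i * v i))
          (∑ i, z i * v i ^ 2 + δ ^ 2) (x * ∑ i, z i * u i) (x * ∑ i, z i * v i)) := by
  rw [integral_mul_smoothSign_mul_smoothSign hδ (integrable_freqProd _ x) (measurable_linForm u)
    (measurable_linForm v) (integrable_norm_freqProd_mul _ x u v), pvGauss,
    ← integral_const_mul (Complex.exp _)]
  congr 1
  refine integral_congr_ae (Filter.Eventually.of_forall fun p => ?_)
  simp only [altSum, ← exp_mul_gauss, jointFourier_freqProd, prod_chirp_eq, neg_sq]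
  ring

/-- A positive definite binary form is coercive, with constant `det / trace`. -/
lemma exists_coercive_const {p q r : ℝ} (hp : 0 ≤ p) (hr : 0 < r) (h : 0 < p * r - q ^ 2) :
    ∃ κ > 0, ∀ t s : ℝ, κ * (t ^ 2 + s ^ 2) ≤ p * t ^ 2 + 2 * q * t * s + r * s ^ 2 := by
  have hpr : 0 < p + r := by linarith
  have hκ : (p * r - q ^ 2) / (p + r) * (p + r) = p * r - q ^ 2 := div_mul_cancel₀ _ hpr.ne'
  set κ := (p * r - q ^ 2) / (p + r) with hκd
  have hκ0 : 0 < κ := div_pos h hpr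
  refine ⟨κ, hκ0, fun t s => ?_⟩
  have h1 : 0 < r - κ := by
    by_contra hneg
    have : r * (p + r) ≤ κ * (p + r) := by gcongr; linarith
    nlinarith [sq_nonneg q, mul_pos hr hr]
  have h2 : 0 ≤ (r - κ) * (p * t ^ 2 + 2 * q * t * s + r * s ^ 2 - κ * (t ^ 2 + s ^ 2)) := by
    have : (r - κ) * (p * t ^ 2 + 2 * q * t * s + r * s ^ 2 - κ * (t ^ 2 + s ^ 2)) =
      ((r - κ) * s + q * t) ^ 2 + (p * r - q ^ 2 - κ * (p + r) + κ ^ 2) * t ^ 2 := by ring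
    rw [this, hκ]
    have : p * r - q ^ 2 - (p * r - q ^ 2) + κ ^ 2 = κ ^ 2 := by ring
    rw [this]
    positivity
  linarith [nonneg_of_mul_nonneg_right h2 h1]

/-- The chirp coefficients certify that the two linear forms are independent. -/
lemma gram_pos {u v a : ι → ℝ} (havv : ∑ i, a i * v i ^ 2 = 0)
    (hauv : ∑ i, a i * (u i * v i) ≠ 0) :
    0 < ∑ i, v i ^ 2 ∧ 0 < (∑ i, u i ^ 2) * (∑ i, v i ^ 2) - (∑ i, u i * v i) ^ 2 := by
  have hr : 0 < ∑ i, v i ^ 2 := by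
    refine lt_of_le_of_ne (Finset.sum_nonneg fun i _ => sq_nonneg _) fun h0 => hauv ?_
    have h1 := (Finset.sum_eq_zero_iff_of_nonneg (fun i _ => sq_nonneg (v i))).1 h0.symm
    refine Finset.sum_eq_zero fun i hi => ?_
    rw [pow_eq_zero_iff two_ne_zero |>.1 (h1 i hi)]
    ring
  refine ⟨hr, ?_⟩
  set p := ∑ i, u i ^ 2
  set r := ∑ i, v i ^ 2
  set q := ∑ i, u i * v i
  have e : ∑ i, (r * u i - q * v i) ^ 2 = r * (p * r - q ^ 2) := by
    have : ∀ i, (r * u i - q * v i) ^ 2 =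
      r ^ 2 * u i ^ 2 - 2 * r * q * (u i * v i) + q ^ 2 * v i ^ 2 := fun i => by ring
    simp only [this, Finset.sum_add_distrib, Finset.sum_sub_distrib, ← Finset.mul_sum]
    change r ^ 2 * p - 2 * r * q * q + q ^ 2 * r = _
    ring
  have h0 : 0 ≤ ∑ i, (r * u i - q * v i) ^ 2 := Finset.sum_nonneg fun i _ => sq_nonneg _
  rcases h0.lt_or_eq with h | h
  · rw [e] at h
    exact pos_of_mul_pos_right h hr.le
  · exfalso
    have h1 := (Finset.sum_eq_zero_iff_of_nonneg (fun i _ => sq_nonneg (r * u i - q * v i))).1 h.symm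
    have h2 : ∑ i, a i * v i * (r * u i - q * v i) = 0 := Finset.sum_eq_zero fun i hi => by
      rw [pow_eq_zero_iff two_ne_zero |>.1 (h1 i hi), mul_zero]
    have h3 : ∑ i, a i * v i * (r * u i - q * v i) =
        r * (∑ i, a i * (u i * v i)) - q * ∑ i, a i * v i ^ 2 := by
      rw [Finset.mul_sum, Finset.mul_sum, ← Finset.sum_sub_distrib]
      exact Finset.sum_congr rfl fun i _ => by ring
    rw [h3, havv, mul_zero, sub_zero] at h2
    exact (mul_ne_zero hr.ne' hauv) h2

/-- The complex parameter `1 + i L a` of a chirp. -/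
noncomputable def chirpParam (L a : ℝ) : ℂ := 1 + (L * a : ℝ) * Complex.I

lemma chirpParam_re (L a : ℝ) : (chirpParam L a).re = 1 := by
  simp [chirpParam]

lemma chirpParam_re_pos (L a : ℝ) : 0 < (chirpParam L a).re := by
  rw [chirpParam_re]; exact one_pos

lemma sum_chirpParam_mul (L : ℝ) (a w : ι → ℝ) :
    ∑ i, chirpParam L (a i) * (w i : ℂ) =
      ((∑ i, w i : ℝ) : ℂ) + ((L * ∑ i, a i * w i : ℝ) : ℂ) * Complex.I := by
  push_cast
  rw [Finset.mul_sum, Finset.sum_mul, ← Finset.sum_add_distrib]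
  refine Finset.sum_congr rfl fun i _ => ?_
  rw [chirpParam]; push_cast; ring

/-- Growth of the principal value for a phase `L (a' t² + 2 b t s)`, uniformly over regularization
parameters `δ` and small linear terms. -/
lemma exists_log_le_norm_pvGauss {κ p q r a' b : ℝ} (U V : ℝ) (hκ : 0 < κ) (hp : 0 ≤ p)
    (hr : 0 < r)
    (hco : ∀ t s : ℝ, κ * (t ^ 2 + s ^ 2) ≤ p * t ^ 2 + 2 * q * t * s + r * s ^ 2) (hb : b ≠ 0) :
    ∃ k > 0, ∃ K ≥ 0, ∃ x₀ > 0, ∀ L ≥ 1, ∀ x : ℝ, |x| ≤ x₀ → x ^ 2 ≤ 1 ∧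
      ∀ δ ∈ Set.Ioo (0 : ℝ) 1, k * Real.log L - K ≤
        ‖pvGauss ((p : ℂ) + ((L * a' : ℝ) : ℂ) * Complex.I + (δ : ℂ) ^ 2)
          ((q : ℂ) + ((L * b : ℝ) : ℂ) * Complex.I) ((r + δ ^ 2 : ℝ) : ℂ) (x * U) (x * V)‖ := by
  set M := p + 1 + |a'| + (q ^ 2 + b ^ 2) / r with hM
  set k₁ := Real.pi * |b| / (2 * Real.sqrt M * Real.sqrt (r + 1)) with hk₁
  set K₁ := 4 * Real.pi * linearBound κ 1 with hK₁
  have hM0 : 0 < M := by rw [hM]; positivity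
  have hb0 : 0 < |b| := abs_pos.2 hb
  have hk₁0 : 0 < k₁ := by rw [hk₁]; positivity
  have hL0 : 0 ≤ linearBound κ 1 := by unfold linearBound; positivity
  have hK₁0 : 0 ≤ K₁ := by rw [hK₁]; positivity
  refine ⟨k₁, hk₁0, K₁, hK₁0, 1 / (1 + |U| + |V|), by positivity, fun L hL x hx => ?_⟩
  have hL0 : 0 < L := by linarith
  have hx1 : |x| * (1 + |U| + |V|) ≤ 1 := by
    rwa [le_div_iff₀ (by positivity)] at hx
  have hxU := mul_nonneg (abs_nonneg x) (abs_nonneg U)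
  have hxV := mul_nonneg (abs_nonneg x) (abs_nonneg V)
  have hxle : |x| ≤ 1 := by linarith
  have hDE : ‖(x : ℂ) * U‖ ^ 2 + ‖(x : ℂ) * V‖ ^ 2 ≤ 1 := by
    rw [norm_mul, norm_mul, Complex.norm_real, Complex.norm_real, Complex.norm_real,
      Real.norm_eq_abs, Real.norm_eq_abs, Real.norm_eq_abs]
    have h1 : |x| * |U| + |x| * |V| ≤ 1 := by linarith [abs_nonneg x]
    have h2 := pow_le_one₀ (add_nonneg hxU hxV) h1 (n := 2)
    linarith [mul_nonneg hxU hxV]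
  refine ⟨by rw [← sq_abs]; exact pow_le_one₀ (abs_nonneg x) hxle, fun δ hδ => ?_⟩
  have hδ0 : 0 < δ := hδ.1
  have hδ1 : δ ^ 2 ≤ 1 := pow_le_one₀ hδ0.le hδ.2.le
  set A : ℂ := (p : ℂ) + ((L * a' : ℝ) : ℂ) * Complex.I with hA
  set B : ℂ := (q : ℂ) + ((L * b : ℝ) : ℂ) * Complex.I with hB
  have hcoer : Coercive κ (A + δ ^ 2) B ((r + δ ^ 2 : ℝ) : ℂ) := by
    intro t s
    have h1 := hco t s
    have e1 : (A + (δ : ℂ) ^ 2).re = p + δ ^ 2 := by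
      rw [← Complex.ofReal_pow, Complex.add_re, Complex.ofReal_re, hA]; simp
    have e2 : B.re = q := by rw [hB]; simp
    rw [e1, e2, Complex.ofReal_re]
    linarith [mul_nonneg (sq_nonneg δ) (sq_nonneg t), mul_nonneg (sq_nonneg δ) (sq_nonneg s)]
  have hAn : ‖A + (δ : ℂ) ^ 2‖ ≤ M * L := by
    have h1 : ‖A + (δ : ℂ) ^ 2‖ ≤ p + L * |a'| + δ ^ 2 := by
      refine (norm_add_le _ _).trans (add_le_add ((norm_add_le _ _).trans (le_of_eq ?_))
        (le_of_eq ?_))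
      · rw [norm_mul, Complex.norm_real, Complex.norm_real, Complex.norm_I, mul_one,
          Real.norm_eq_abs, Real.norm_eq_abs, abs_mul, abs_of_nonneg hp, abs_of_pos hL0]
      · rw [norm_pow, Complex.norm_real, Real.norm_eq_abs, sq_abs]
    have h2 : 0 ≤ (q ^ 2 + b ^ 2) / r := by positivity
    have h3 : p + 1 ≤ (p + 1) * L := le_mul_of_one_le_right (by linarith) hL
    have h4 : M * L = (p + 1) * L + L * |a'| + (q ^ 2 + b ^ 2) / r * L := by rw [hM]; ring
    have h5 := mul_nonneg h2 hL0.le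
    linarith
  have hBsq : ‖B‖ ^ 2 = q ^ 2 + L ^ 2 * b ^ 2 := by
    rw [← Complex.normSq_eq_norm_sq, hB, Complex.normSq_add_mul_I]; ring
  have hBn : ‖B‖ ^ 2 ≤ M * (r + δ ^ 2) * L ^ 2 := by
    rw [hBsq]
    have hL2 : 1 ≤ L ^ 2 := by nlinarith
    have h1 : q ^ 2 + L ^ 2 * b ^ 2 ≤ (q ^ 2 + b ^ 2) * L ^ 2 := by
      nlinarith [mul_le_mul_of_nonneg_left hL2 (sq_nonneg q)]
    have h2 : (q ^ 2 + b ^ 2) ≤ M * (r + δ ^ 2) := by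
      have h3 : (q ^ 2 + b ^ 2) / r ≤ M := by
        rw [hM]; linarith [abs_nonneg a']
      rw [div_le_iff₀ hr] at h3
      nlinarith [mul_nonneg hM0.le (sq_nonneg δ)]
    exact h1.trans (by gcongr)
  have hBl : |b| * L ≤ ‖B‖ := by
    rw [← sq_le_sq₀ (by positivity) (norm_nonneg _), hBsq, mul_pow, sq_abs]
    linarith [sq_nonneg q]
  have hlogL := Real.log_nonneg hL
  have low := log_le_norm_pvGauss hκ hcoer hb0 hL hAn hBn hBl
  have low2 : k₁ * Real.log L ≤
      ‖pvGauss (A + δ ^ 2) B ((r + δ ^ 2 : ℝ) : ℂ) 0 0‖ := by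
    refine le_trans ?_ low
    rw [hk₁, div_mul_eq_mul_div]
    gcongr
  have hdiff := norm_pvGauss_sub_le hκ hcoer hDE
  have := norm_sub_norm_le (pvGauss (A + δ ^ 2) B ((r + δ ^ 2 : ℝ) : ℂ) 0 0)
    (pvGauss (A + δ ^ 2) B ((r + δ ^ 2 : ℝ) : ℂ) (x * U) (x * V))
  rw [norm_sub_rev] at this
  linarith

/-- The vanishing conditions on `a` remove all the quadratic phases of
`∏ fᵢ(x + uᵢ t + vᵢ s)` that involve `x t`, `x s` or `s²`, while keeping the phase `t s`; the
double principal value then diverges logarithmically, uniformly in `x` near `0`. -/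
theorem exists_log_le_norm_doubleSign {u v a : ι → ℝ} (hau : ∑ i, a i * u i = 0)
    (hav : ∑ i, a i * v i = 0) (havv : ∑ i, a i * v i ^ 2 = 0)
    (hauv : ∑ i, a i * (u i * v i) ≠ 0) :
    ∃ k > 0, ∃ K : ℝ, ∃ x₀ > 0, ∀ L ≥ 1, ∀ x : ℝ, |x| ≤ x₀ →
      k * Real.log L - K ≤
        ‖doubleSign u v (fun i => chirp (chirpParam L (a i)) (chirpParam_re_pos _ _) 0) x‖ := by
  obtain ⟨hr, hdet⟩ := gram_pos havv hauv
  have hp : 0 ≤ ∑ i, u i ^ 2 := Finset.sum_nonneg fun i _ => sq_nonneg _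
  obtain ⟨κ, hκ, hco⟩ := exists_coercive_const hp hr hdet
  set p := ∑ i, u i ^ 2 with hpd
  set r := ∑ i, v i ^ 2 with hrd
  set q := ∑ i, u i * v i with hqd
  set b := ∑ i, a i * (u i * v i) with hbd
  set a' := ∑ i, a i * u i ^ 2 with ha'd
  set U := ∑ i, u i with hUd
  set V := ∑ i, v i with hVd
  obtain ⟨k₁, hk₁0, K₁, hK₁0, x₀, hx₀, hpv⟩ :=
    exists_log_le_norm_pvGauss (a' := a') U V hκ hp hr hco hauv
  set N : ℝ := (Fintype.card ι : ℝ) with hN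
  set ε := 1 / Real.pi ^ 2 * Real.exp (-Real.pi * N) with hε
  have hε0 : 0 < ε := by rw [hε]; positivity
  refine ⟨ε * k₁, by positivity, 1 / Real.pi ^ 2 * K₁, x₀, hx₀, fun L hL x hx => ?_⟩
  obtain ⟨hx2, hpv⟩ := hpv L hL x hx
  have eA : ∑ i, chirpParam L (a i) * (u i : ℂ) ^ 2 = (p : ℂ) + ((L * a' : ℝ) : ℂ) * Complex.I := by
    have := sum_chirpParam_mul L a (fun i => u i ^ 2)
    push_cast at this
    rw [this, hpd, ha'd]; push_cast; rfl
  have eB : ∑ i, chirpParam L (a i) * ((u i : ℂ) * (v i : ℂ)) = (q : ℂ) + ((L * b : ℝ) : ℂ) * Complex.I := by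
    have := sum_chirpParam_mul L a (fun i => u i * v i)
    push_cast at this
    rw [this, hqd, hbd]; push_cast; rfl
  have eC : ∑ i, chirpParam L (a i) * (v i : ℂ) ^ 2 = (r : ℂ) := by
    have := sum_chirpParam_mul L a (fun i => v i ^ 2)
    rw [havv] at this
    push_cast at this
    rw [this, hrd]; push_cast; simp
  have eD : ∑ i, chirpParam L (a i) * (u i : ℂ) = (U : ℂ) := by
    rw [sum_chirpParam_mul L a u, hau]; simp [hUd]
  have eE : ∑ i, chirpParam L (a i) * (v i : ℂ) = (V : ℂ) := by
    rw [sum_chirpParam_mul L a v, hav]; simp [hVd]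
  have hlim := tendsto_integral_mul_smoothSign
    (integrable_freqProd (fun i => chirp (chirpParam L (a i)) (chirpParam_re_pos _ _) 0) x)
    (measurable_linForm u) (measurable_linForm v)
  refine ge_of_tendsto hlim.norm ?_
  filter_upwards [Ioo_mem_nhdsGT (zero_lt_one' ℝ)] with δ hδ
  have hδ0 : 0 < δ := hδ.1
  rw [integral_smoothSign_chirp _ _ u v x hδ0, eA, eB, eC, eD, eE]
  have hC : (r : ℂ) + (δ : ℂ) ^ 2 = ((r + δ ^ 2 : ℝ) : ℂ) := by push_cast; rfl
  rw [hC]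
  have hlogL := Real.log_nonneg hL
  have low3 := hpv δ hδ
  have hP : ‖Complex.exp (-Real.pi * x ^ 2 * ∑ i, chirpParam L (a i))‖ =
      Real.exp (-Real.pi * N * x ^ 2) := by
    rw [Complex.norm_exp, show (-Real.pi * x ^ 2 * ∑ i, chirpParam L (a i) : ℂ) =
      ((-Real.pi * x ^ 2 : ℝ) : ℂ) * ∑ i, chirpParam L (a i) by push_cast; ring,
      Complex.re_ofReal_mul, Complex.re_sum]
    simp only [chirpParam_re]
    simp [hN]
    ring
  have hPl : Real.exp (-Real.pi * N) ≤ Real.exp (-Real.pi * N * x ^ 2) := by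
    rw [Real.exp_le_exp]
    have : 0 ≤ Real.pi * N := by positivity
    have := mul_le_mul_of_nonneg_left hx2 this
    linarith
  have hPu : Real.exp (-Real.pi * N * x ^ 2) ≤ 1 := by
    rw [Real.exp_le_one_iff]
    have : 0 ≤ Real.pi * N * x ^ 2 := by positivity
    linarith
  have hc : ‖(-(1 / Real.pi ^ 2) : ℂ)‖ = 1 / Real.pi ^ 2 := by
    rw [norm_neg, norm_div, norm_pow, norm_one, Complex.norm_real, Real.norm_eq_abs, sq_abs]
  rw [norm_mul, norm_mul, hP, hc]
  set e := Real.exp (-Real.pi * N * x ^ 2)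
  have he0 : 0 ≤ e := (Real.exp_pos _).le
  have hpi2 : 0 < 1 / Real.pi ^ 2 := by positivity
  have f1 : Real.exp (-Real.pi * N) * (k₁ * Real.log L) ≤ e * (k₁ * Real.log L) := by gcongr
  have f2 : e * K₁ ≤ K₁ := mul_le_of_le_one_left hK₁0 hPu
  have f3 := mul_le_mul_of_nonneg_left low3 he0
  set Z := ‖pvGauss ((p : ℂ) + ((L * a' : ℝ) : ℂ) * Complex.I + (δ : ℂ) ^ 2)
    ((q : ℂ) + ((L * b : ℝ) : ℂ) * Complex.I) ((r + δ ^ 2 : ℝ) : ℂ) (x * U) (x * V)‖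
  have f4 : Real.exp (-Real.pi * N) * (k₁ * Real.log L) - K₁ ≤ e * Z := by linarith
  have f5 := mul_le_mul_of_nonneg_left f4 hpi2.le
  rw [hε]
  linarith

end Growth

/-! ### Reduction to two signs by modulation -/

/-- The vector `(1, α)` of coefficients of the linear form `ξ₀ + ∑ αᵢ ξᵢ`. -/
def formVec {d : ℕ} (β : Fin d → ℝ) : Fin (d + 1) → ℝ := Fin.cons 1 β

lemma symbol_eq {d k : ℕ} (α : Fin k → Fin d → ℝ) (ξ : Fin (d + 1) → ℝ) :
    symbol α ξ = ∏ j, Real.sign (linForm (formVec (α j)) ξ) := by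
  simp [symbol, linForm, formVec, Fin.sum_univ_succ]

lemma abs_sign_le_one (x : ℝ) : |Real.sign x| ≤ 1 := by
  rcases Real.sign_apply_eq x with h | h | h <;> simp [h]

lemma abs_sign_of_ne_zero {x : ℝ} (hx : x ≠ 0) : |Real.sign x| = 1 := by
  rcases Real.sign_apply_eq_of_ne_zero x hx with h | h <;> simp [h]

lemma abs_symbol_le_one {d k : ℕ} (α : Fin k → Fin d → ℝ) (ξ : Fin (d + 1) → ℝ) :
    |symbol α ξ| ≤ 1 := by
  rw [symbol, Finset.abs_prod]
  exact Finset.prod_le_one (fun _ _ => abs_nonneg _) fun _ _ => abs_sign_le_one _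

lemma measurable_real_sign : Measurable Real.sign := by
  unfold Real.sign
  exact Measurable.ite measurableSet_Iio measurable_const
    (Measurable.ite measurableSet_Ioi measurable_const measurable_const)

lemma measurable_symbol {d k : ℕ} (α : Fin k → Fin d → ℝ) : Measurable (symbol α) := by
  unfold symbol
  exact Finset.measurable_fun_prod _ fun j _ => measurable_real_sign.comp (by fun_prop)

open Filter Topology in
lemma tendsto_sign_add_nat_mul (a : ℝ) {b : ℝ} (hb : b ≠ 0) :
    Tendsto (fun n : ℕ => Real.sign (a + n * b)) atTop (𝓝 (Real.sign b)) := by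
  refine tendsto_const_nhds.congr' ?_
  rcases lt_or_gt_of_ne hb with hb | hb
  · have h : Tendsto (fun n : ℕ => a + n * b) atTop atBot :=
      tendsto_atBot_add_const_left _ _ (tendsto_natCast_atTop_atTop.atTop_mul_const_of_neg hb)
    filter_upwards [h.eventually_lt_atBot 0] with n hn
    rw [Real.sign_of_neg hb, Real.sign_of_neg hn]
  · have h : Tendsto (fun n : ℕ => a + n * b) atTop atTop :=
      tendsto_atTop_add_const_left _ _ (tendsto_natCast_atTop_atTop.atTop_mul_const hb)
    filter_upwards [h.eventually_gt_atTop 0] with n hn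
    rw [Real.sign_of_pos hb, Real.sign_of_pos hn]

lemma linForm_add_smul {ι : Type*} [Fintype ι] (u ξ w : ι → ℝ) (R : ℝ) :
    linForm u (ξ + R • w) = linForm u ξ + R * linForm u w := by
  simp only [linForm, Pi.add_apply, Pi.smul_apply, smul_eq_mul, mul_add, Finset.sum_add_distrib,
    Finset.mul_sum]
  congr 1
  exact Finset.sum_congr rfl fun i _ => by ring

/-- The operator with symbol translated by `R w`. -/
noncomputable def shiftedOp {d k : ℕ} (α : Fin k → Fin d → ℝ) (w : Fin (d + 1) → ℝ) (R : ℝ)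
    (f : Fin (d + 1) → 𝓢(ℝ, ℂ)) (x : ℝ) : ℂ :=
  ∫ ξ, (symbol α (ξ + R • w) : ℂ) * freqProd f x ξ

/-- Modulating the functions translates the symbol, up to a unimodular factor. -/
lemma norm_nHT_chirp {d k : ℕ} (α : Fin k → Fin d → ℝ) (w : Fin (d + 1) → ℝ) (R : ℝ)
    (z : Fin (d + 1) → ℂ) (hz : ∀ i, 0 < (z i).re) (x : ℝ) :
    ‖nHT α (fun i => chirp (z i) (hz i) (R * w i)) x‖ =
      ‖shiftedOp α w R (fun i => chirp (z i) (hz i) 0) x‖ := by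
  have h : nHT α (fun i => chirp (z i) (hz i) (R * w i)) x =
      Complex.exp ((2 * Real.pi * x * (R * ∑ i, w i) : ℝ) * Complex.I) *
        shiftedOp α w R (fun i => chirp (z i) (hz i) 0) x := by
    rw [nHT, ← integral_add_right_eq_self _ (R • w), shiftedOp, ← integral_const_mul]
    refine integral_congr_ae (Filter.Eventually.of_forall fun ξ => ?_)
    simp only [freqProd]
    have e1 : ∀ i, 𝓕 (chirp (z i) (hz i) (R * w i) : ℝ → ℂ) ((ξ + R • w) i) =
        𝓕 (chirp (z i) (hz i) 0 : ℝ → ℂ) (ξ i) := by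
      intro i
      rw [fourier_chirp]
      simp
    simp only [e1]
    have e2 : Complex.exp (2 * Real.pi * Complex.I * x * ∑ i, (((ξ + R • w) i : ℝ) : ℂ)) =
        Complex.exp ((2 * Real.pi * x * (R * ∑ i, w i) : ℝ) * Complex.I) *
        Complex.exp (2 * Real.pi * Complex.I * x * ∑ i, (ξ i : ℂ)) := by
      rw [← Complex.exp_add]
      congr 1
      simp only [Pi.add_apply, Pi.smul_apply, smul_eq_mul]
      push_cast
      rw [Finset.sum_add_distrib, ← Finset.mul_sum]
      ring
    rw [e2]
    ring
  rw [h, norm_mul, Complex.norm_exp_ofReal_mul_I, one_mul]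

lemma aestronglyMeasurable_shiftedOp {d k : ℕ} (α : Fin k → Fin d → ℝ) (w : Fin (d + 1) → ℝ)
    (R : ℝ) (f : Fin (d + 1) → 𝓢(ℝ, ℂ)) :
    AEStronglyMeasurable (shiftedOp α w R f) volume := by
  have h : Measurable (fun q : ℝ × (Fin (d + 1) → ℝ) =>
      (symbol α (q.2 + R • w) : ℂ) * freqProd f q.1 q.2) := by
    refine (Complex.measurable_ofReal.comp ((measurable_symbol α).comp ?_)).mul
      (continuous_freqProd f).measurable
    exact measurable_snd.add_const _
  exact (h.stronglyMeasurable.integral_prod_right (ν := volume)).aestronglyMeasurable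

open Filter Topology in
lemma tendsto_shiftedOp {d k : ℕ} (α : Fin k → Fin d → ℝ) {w : Fin (d + 1) → ℝ} {j₀ j₁ : Fin k}
    (hj : j₀ ≠ j₁) (h0 : linForm (formVec (α j₀)) w = 0) (h1 : linForm (formVec (α j₁)) w = 0)
    (f : Fin (d + 1) → 𝓢(ℝ, ℂ)) (x : ℝ)
    (hw : ∀ j, j ≠ j₀ → j ≠ j₁ → linForm (formVec (α j)) w ≠ 0) :
    Tendsto (fun n : ℕ => shiftedOp α w n f x) atTop
      (𝓝 (((∏ j ∈ (Finset.univ.erase j₀).erase j₁, Real.sign (linForm (formVec (α j)) w) : ℝ) : ℂ) *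
        doubleSign (formVec (α j₀)) (formVec (α j₁)) f x)) := by
  rw [doubleSign, ← integral_const_mul]
  refine tendsto_integral_of_dominated_convergence (fun ξ => ‖freqProd f x ξ‖) ?_
    (integrable_freqProd f x).norm ?_ ?_
  · intro n
    refine Measurable.aestronglyMeasurable ?_ |>.mul (integrable_freqProd f x).1
    exact Complex.measurable_ofReal.comp ((measurable_symbol α).comp (measurable_id.add_const _))
  · intro n
    refine Eventually.of_forall fun ξ => ?_
    rw [norm_mul, Complex.norm_real]
    exact mul_le_of_le_one_left (norm_nonneg _) (abs_symbol_le_one _ _)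
  · refine Eventually.of_forall fun ξ => ?_
    have hmem : j₁ ∈ Finset.univ.erase j₀ := Finset.mem_erase.2 ⟨hj.symm, Finset.mem_univ _⟩
    have hsplit : ∀ n : ℕ, symbol α (ξ + (n : ℝ) • w) =
        Real.sign (linForm (formVec (α j₀)) ξ) * (Real.sign (linForm (formVec (α j₁)) ξ) *
          ∏ j ∈ (Finset.univ.erase j₀).erase j₁,
            Real.sign (linForm (formVec (α j)) ξ + n * linForm (formVec (α j)) w)) := by
      intro n
      rw [symbol_eq, ← Finset.mul_prod_erase _ _ (Finset.mem_univ j₀),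
        ← Finset.mul_prod_erase _ _ hmem]
      simp only [linForm_add_smul, h0, h1, mul_zero, add_zero]
    have hlim : Tendsto (fun n : ℕ => symbol α (ξ + (n : ℝ) • w)) atTop
        (𝓝 (Real.sign (linForm (formVec (α j₀)) ξ) * (Real.sign (linForm (formVec (α j₁)) ξ) *
          ∏ j ∈ (Finset.univ.erase j₀).erase j₁, Real.sign (linForm (formVec (α j)) w)))) := by
      simp only [hsplit]
      refine tendsto_const_nhds.mul (tendsto_const_nhds.mul (tendsto_finsetProd _ fun j hj' => ?_))
      simp only [Finset.mem_erase, Finset.mem_univ, and_true] at hj'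
      exact tendsto_sign_add_nat_mul _ (hw j hj'.2 hj'.1)
    have := ((Complex.continuous_ofReal.tendsto _).comp hlim).mul_const (freqProd f x ξ)
    convert! this using 2
    push_cast
    ring

open Filter Topology in
/-- A Hölder type estimate for the full symbol, tested on modulated chirps, gives a bound for the
operator with the two signs whose forms vanish at the modulation direction. -/
lemma exists_eLpNorm_doubleSign_le {d k : ℕ} {α : Fin k → Fin d → ℝ} {w : Fin (d + 1) → ℝ}
    {j₀ j₁ : Fin k} (hj : j₀ ≠ j₁) (h0 : linForm (formVec (α j₀)) w = 0)
    (h1 : linForm (formVec (α j₁)) w = 0)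
    (hw : ∀ j, j ≠ j₀ → j ≠ j₁ → linForm (formVec (α j)) w ≠ 0)
    {p : Fin (d + 1) → ℝ≥0∞} {q : ℝ≥0∞} (hb : IsBoundedOnLp (nHT α) p q) :
    ∃ C < ∞, ∀ z : Fin (d + 1) → ℂ, ∀ hz : ∀ i, 0 < (z i).re, (∀ i, (z i).re = 1) →
      eLpNorm (doubleSign (formVec (α j₀)) (formVec (α j₁)) (fun i => chirp (z i) (hz i) 0)) q
        volume ≤ C := by
  obtain ⟨C, hC⟩ := hb
  refine ⟨C * ∏ i, eLpNorm (chirp 1 (by simp) 0 : ℝ → ℂ) (p i) volume, ?_, fun z hz hz1 => ?_⟩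
  · exact ENNReal.mul_lt_top ENNReal.coe_lt_top
      (ENNReal.prod_lt_top fun i _ => SchwartzMap.eLpNorm_lt_top _ _ _)
  set f : Fin (d + 1) → 𝓢(ℝ, ℂ) := fun i => chirp (z i) (hz i) 0
  set σ : ℝ := ∏ j ∈ (Finset.univ.erase j₀).erase j₁, Real.sign (linForm (formVec (α j)) w) with hσ
  have hσ1 : |σ| = 1 := by
    rw [hσ, Finset.abs_prod]
    refine Finset.prod_eq_one fun j hj' => ?_
    simp only [Finset.mem_erase, Finset.mem_univ, and_true] at hj'
    exact abs_sign_of_ne_zero (hw j hj'.2 hj'.1)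
  have hbound : ∀ n : ℕ, eLpNorm (shiftedOp α w n f) q volume ≤
      C * ∏ i, eLpNorm (chirp 1 (by simp) 0 : ℝ → ℂ) (p i) volume := by
    intro n
    have e1 : eLpNorm (shiftedOp α w n f) q volume =
        eLpNorm (nHT α (fun i => chirp (z i) (hz i) (n * w i))) q volume :=
      eLpNorm_congr_norm_ae (Eventually.of_forall fun x => (norm_nHT_chirp α w n z hz x).symm)
    rw [e1]
    refine (hC _).trans (le_of_eq ?_)
    congr 1
    exact Finset.prod_congr rfl fun i _ => eLpNorm_chirp (z i) (hz i) (hz1 i) _ _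
  have e2 : eLpNorm (doubleSign (formVec (α j₀)) (formVec (α j₁)) f) q volume =
      eLpNorm (fun x => (σ : ℂ) * doubleSign (formVec (α j₀)) (formVec (α j₁)) f x) q volume := by
    refine eLpNorm_congr_norm_ae (Eventually.of_forall fun x => ?_)
    rw [norm_mul, Complex.norm_real, Real.norm_eq_abs, hσ1, one_mul]
  rw [e2]
  refine (Lp.eLpNorm_lim_le_liminf_eLpNorm
    (fun n : ℕ => aestronglyMeasurable_shiftedOp α w n f) _
    (Eventually.of_forall fun x => tendsto_shiftedOp α hj h0 h1 f x hw)).trans ?_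
  refine liminf_le_of_le (by isBoundedDefault) fun b hb' => ?_
  obtain ⟨n, hn⟩ := hb'.exists
  exact hn.trans (hbound n)

open Filter Topology in
/-- A direction `w` singling out two of the forms, together with chirp coefficients `a` for them,
excludes every Hölder type estimate. -/
theorem not_satisfiesSomeHolderEstimate {d k : ℕ} {α : Fin k → Fin d → ℝ}
    {a w : Fin (d + 1) → ℝ} {j₀ j₁ : Fin k} (hj : j₀ ≠ j₁)
    (h0 : linForm (formVec (α j₀)) w = 0) (h1 : linForm (formVec (α j₁)) w = 0)
    (hw : ∀ j, j ≠ j₀ → j ≠ j₁ → linForm (formVec (α j)) w ≠ 0)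
    (hau : ∑ i, a i * formVec (α j₀) i = 0) (hav : ∑ i, a i * formVec (α j₁) i = 0)
    (havv : ∑ i, a i * formVec (α j₁) i ^ 2 = 0)
    (hauv : ∑ i, a i * (formVec (α j₀) i * formVec (α j₁) i) ≠ 0) :
    ¬ SatisfiesSomeHolderEstimate (nHT α) := by
  rintro ⟨p, q, -, hq0, hq, -, hb⟩
  obtain ⟨C, hC, hbd⟩ := exists_eLpNorm_doubleSign_le hj h0 h1 hw hb
  obtain ⟨k, hk, K, x₀, hx₀, hlow⟩ := exists_log_le_norm_doubleSign hau hav havv hauv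
  set S : Set ℝ := Set.Icc (-x₀) x₀ with hS
  have hvol : volume S ^ (1 / q.toReal) ≠ 0 := by
    rw [hS, Real.volume_Icc]
    have : 0 < ENNReal.ofReal (x₀ - -x₀) := ENNReal.ofReal_pos.2 (by linarith)
    exact (ENNReal.rpow_pos this ENNReal.ofReal_ne_top).ne'
  have key : ∀ L : ℝ, 1 ≤ L → 0 ≤ k * Real.log L - K →
      ENNReal.ofReal (k * Real.log L - K) * volume S ^ (1 / q.toReal) ≤ C := by
    intro L hL hpos
    set c : ℝ := k * Real.log L - K with hc
    have h2 := hbd (fun i => chirpParam L (a i)) (fun i => chirpParam_re_pos _ _)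
      (fun i => chirpParam_re _ _)
    have hm : ∀ x : ℝ, ‖S.indicator (fun _ => c) x‖ ≤
        ‖doubleSign (formVec (α j₀)) (formVec (α j₁))
          (fun i => chirp (chirpParam L (a i)) (chirpParam_re_pos _ _) 0) x‖ := by
      intro x
      by_cases hx : x ∈ S
      · rw [Set.indicator_of_mem hx, Real.norm_eq_abs, abs_of_nonneg hpos]
        exact hlow L hL x (abs_le.2 hx)
      · rw [Set.indicator_of_notMem hx, norm_zero]
        exact norm_nonneg _
    have h3 := (eLpNorm_mono (p := q) (μ := volume) hm).trans h2
    rwa [eLpNorm_indicator_const measurableSet_Icc hq0.ne' hq.ne, Real.enorm_eq_ofReal hpos] at h3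
  have htop : Tendsto (fun L : ℝ => ENNReal.ofReal (k * Real.log L - K) *
      volume S ^ (1 / q.toReal)) atTop (𝓝 ∞) := by
    have h2 : Tendsto (fun L : ℝ => k * Real.log L - K) atTop atTop :=
      tendsto_atTop_add_const_right _ (-K) (Real.tendsto_log_atTop.const_mul_atTop hk)
    have h3 := ENNReal.Tendsto.mul_const (b := volume S ^ (1 / q.toReal))
      (ENNReal.tendsto_ofReal_atTop.comp h2) (Or.inl ENNReal.top_ne_zero)
    rwa [ENNReal.top_mul hvol] at h3
  have hpos : ∀ᶠ L : ℝ in atTop, 0 ≤ k * Real.log L - K :=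
    (tendsto_atTop_add_const_right _ (-K)
      (Real.tendsto_log_atTop.const_mul_atTop hk)).eventually_ge_atTop 0
  obtain ⟨L, h2, h3, h4⟩ := ((htop.eventually (lt_mem_nhds hC)).and
    (hpos.and (eventually_ge_atTop 1))).exists
  exact absurd (key L h4 h3) (not_le.2 h2)

/-! ### Genericity -/

section Generic

open Matrix

variable {d k : ℕ}

lemma sum_mul_extend {m n : ℕ} {e : Fin m → Fin n} (he : Function.Injective e) (W : Fin m → ℝ)
    (g : Fin n → ℝ) : ∑ i, g i * Function.extend e W 0 i = ∑ c, g (e c) * W c := by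
  refine (Fintype.sum_of_injective e he _ _ (fun i hi => ?_) fun c => ?_).symm
  · rw [Function.extend_apply' _ _ _ (by simpa using hi)]; simp
  · rw [he.extend_apply]

/-- The generic version of `formVec (α j)`, with polynomial entries. -/
noncomputable def polyVec (j : Fin k) : Fin (d + 1) → MvPolynomial (Fin k × Fin d) ℝ :=
  Fin.cons 1 fun i => MvPolynomial.X (j, i)

lemma eval_polyVec (α : Fin k → Fin d → ℝ) (j : Fin k) (i : Fin (d + 1)) :
    MvPolynomial.eval (fun ji => α ji.1 ji.2) (polyVec j i) = formVec (α j) i := by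
  refine Fin.cases ?_ (fun i => ?_) i <;> simp [polyVec, formVec]

/-- The determinant of three of the forms, restricted to the first three coordinates. -/
noncomputable def formDet (hd : 3 ≤ d + 1) (j₀ j₁ j : Fin k) : MvPolynomial (Fin k × Fin d) ℝ :=
  Matrix.det (Matrix.of ![fun c => polyVec j (Fin.castLE hd c),
    fun c => polyVec j₀ (Fin.castLE hd c), fun c => polyVec j₁ (Fin.castLE hd c)])

lemma eval_formDet (hd : 3 ≤ d + 1) (j₀ j₁ j : Fin k) (α : Fin k → Fin d → ℝ) :
    MvPolynomial.eval (fun ji => α ji.1 ji.2) (formDet hd j₀ j₁ j) =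
      Matrix.det (Matrix.of ![fun c => formVec (α j) (Fin.castLE hd c),
        fun c => formVec (α j₀) (Fin.castLE hd c), fun c => formVec (α j₁) (Fin.castLE hd c)]) := by
  rw [formDet, RingHom.map_det]
  congr 1
  ext a b
  fin_cases a <;> simp [eval_polyVec]

lemma formDet_ne_zero (hd : 4 ≤ d + 1) {j₀ j₁ j : Fin k} (h01 : j₀ ≠ j₁) (h0 : j ≠ j₀)
    (h1 : j ≠ j₁) : formDet (d := d) (by omega) j₀ j₁ j ≠ 0 := by
  intro h
  have := eval_formDet (by omega) j₀ j₁ j (fun (j' : Fin k) (i : Fin d) =>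
    if j' = j₀ then 0 else if j' = j₁ then (if i.val = 0 then 1 else 0)
      else (if i.val = 1 then 1 else 0))
  have c0 : ∀ β : Fin d → ℝ, formVec β 0 = 1 := fun β => rfl
  have c1 : ∀ β : Fin d → ℝ, formVec β (Fin.castLE (by omega) (1 : Fin 3)) = β ⟨0, by omega⟩ :=
    fun β => rfl
  have c2 : ∀ β : Fin d → ℝ, formVec β (Fin.castLE (by omega) (2 : Fin 3)) = β ⟨1, by omega⟩ :=
    fun β => rfl
  rw [h, Matrix.det_fin_three] at this
  simp [c0, c1, c2, h01.symm, h0, h1] at this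

/-- If the determinants do not vanish, the cross product of two of the forms is a direction on
which only these two vanish. -/
lemma exists_direction (hd : 3 ≤ d + 1) (α : Fin k → Fin d → ℝ) (j₀ j₁ : Fin k) :
    ∃ w : Fin (d + 1) → ℝ, linForm (formVec (α j₀)) w = 0 ∧ linForm (formVec (α j₁)) w = 0 ∧
      ∀ j, linForm (formVec (α j)) w =
        MvPolynomial.eval (fun ji => α ji.1 ji.2) (formDet hd j₀ j₁ j) := by
  set r : Fin k → Fin 3 → ℝ := fun j c => formVec (α j) (Fin.castLE hd c) with hr
  have h : ∀ j, linForm (formVec (α j)) (Function.extend (Fin.castLE hd)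
      (crossProduct (r j₀) (r j₁)) 0) = r j ⬝ᵥ crossProduct (r j₀) (r j₁) := fun j => by
    rw [linForm, sum_mul_extend (Fin.castLE_injective hd)]
    rfl
  refine ⟨_, (h j₀).trans (dot_self_cross _ _), (h j₁).trans (dot_cross_self _ _), fun j => ?_⟩
  rw [h, triple_product_eq_det, eval_formDet]
  rfl

/-- The determinant of the linear system for the chirp coefficients on four coordinates. -/
noncomputable def chirpDet (hd : 4 ≤ d + 1) (j₀ j₁ : Fin k) : MvPolynomial (Fin k × Fin d) ℝ :=
  Matrix.det (Matrix.of ![fun c => polyVec j₀ (Fin.castLE hd c),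
    fun c => polyVec j₁ (Fin.castLE hd c), fun c => polyVec j₁ (Fin.castLE hd c) ^ 2,
    fun c => polyVec j₀ (Fin.castLE hd c) * polyVec j₁ (Fin.castLE hd c)])

/-- The value of the matrix in `chirpDet` at a tuple of vectors. -/
def chirpMatrix (hd : 4 ≤ d + 1) (α : Fin k → Fin d → ℝ) (j₀ j₁ : Fin k) :
    Matrix (Fin 4) (Fin 4) ℝ :=
  Matrix.of ![fun c => formVec (α j₀) (Fin.castLE hd c), fun c => formVec (α j₁) (Fin.castLE hd c),
    fun c => formVec (α j₁) (Fin.castLE hd c) ^ 2,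
    fun c => formVec (α j₀) (Fin.castLE hd c) * formVec (α j₁) (Fin.castLE hd c)]

lemma eval_chirpDet (hd : 4 ≤ d + 1) (j₀ j₁ : Fin k) (α : Fin k → Fin d → ℝ) :
    MvPolynomial.eval (fun ji => α ji.1 ji.2) (chirpDet hd j₀ j₁) =
      (chirpMatrix hd α j₀ j₁).det := by
  rw [chirpDet, RingHom.map_det, chirpMatrix]
  congr 1
  ext a b
  fin_cases a <;> simp [eval_polyVec]

/-- The determinant takes a nonzero value at an explicit tuple of vectors. -/
lemma chirpDet_ne_zero (hd : 4 ≤ d + 1) {j₀ j₁ : Fin k} (h01 : j₀ ≠ j₁) :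
    chirpDet hd j₀ j₁ ≠ 0 := by
  intro h
  -- the four columns are those of the points `(1, 1)`, `(1, 0)`, `(0, 2)`, `(0, -1)`
  have := eval_chirpDet hd j₀ j₁ (fun (j' : Fin k) (i : Fin d) =>
    if j' = j₀ then (if i.val = 0 then 1 else 0)
      else (if i.val = 1 then 2 else if i.val = 2 then -1 else 0))
  have c0 : ∀ β : Fin d → ℝ, formVec β 0 = 1 := fun β => rfl
  have c1 : ∀ β : Fin d → ℝ, formVec β (Fin.castLE hd (1 : Fin 4)) = β ⟨0, by omega⟩ :=
    fun β => rfl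
  have c2 : ∀ β : Fin d → ℝ, formVec β (Fin.castLE hd (2 : Fin 4)) = β ⟨1, by omega⟩ :=
    fun β => rfl
  have c3 : ∀ β : Fin d → ℝ, formVec β (Fin.castLE hd (3 : Fin 4)) = β ⟨2, by omega⟩ :=
    fun β => rfl
  have hM : chirpMatrix hd (fun (j' : Fin k) (i : Fin d) =>
    if j' = j₀ then (if i.val = 0 then 1 else 0)
      else (if i.val = 1 then 2 else if i.val = 2 then -1 else 0)) j₀ j₁ =
      !![1, 1, 0, 0; 1, 0, 2, -1; 1, 0, 4, 1; 1, 0, 0, 0] := by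
    ext a b
    fin_cases a <;> fin_cases b <;> simp [chirpMatrix, c0, c1, c2, c3, h01.symm]
    norm_num
  rw [h, hM, Matrix.det_succ_row_zero] at this
  simp [Fin.sum_univ_succ, Matrix.det_fin_three, Matrix.submatrix, Fin.succAbove] at this
  norm_num at this

lemma exists_chirp_coeff (hd : 4 ≤ d + 1) (α : Fin k → Fin d → ℝ) {j₀ j₁ : Fin k}
    (h : (chirpMatrix hd α j₀ j₁).det ≠ 0) :
    ∃ a : Fin (d + 1) → ℝ, ∑ i, a i * formVec (α j₀) i = 0 ∧ ∑ i, a i * formVec (α j₁) i = 0 ∧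
      ∑ i, a i * formVec (α j₁) i ^ 2 = 0 ∧
      ∑ i, a i * (formVec (α j₀) i * formVec (α j₁) i) = 1 := by
  set M := chirpMatrix hd α j₀ j₁ with hM
  set W : Fin 4 → ℝ := M⁻¹ *ᵥ ![0, 0, 0, 1]
  have hW : M *ᵥ W = ![0, 0, 0, 1] := by
    rw [Matrix.mulVec_mulVec, Matrix.mul_nonsing_inv _ (isUnit_iff_ne_zero.2 h), Matrix.one_mulVec]
  have hs : ∀ g : Fin (d + 1) → ℝ, ∑ i, Function.extend (Fin.castLE hd) W 0 i * g i =
      ∑ c, g (Fin.castLE hd c) * W c := fun g => by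
    simp only [mul_comm _ (g _)]
    exact sum_mul_extend (Fin.castLE_injective hd) W g
  refine ⟨Function.extend (Fin.castLE hd) W 0, ?_, ?_, ?_, ?_⟩
  · rw [hs]; exact congrFun hW 0
  · rw [hs]; exact congrFun hW 1
  · rw [hs (fun i => formVec (α j₁) i ^ 2)]; exact congrFun hW 2
  · rw [hs (fun i => formVec (α j₀) i * formVec (α j₁) i)]; exact congrFun hW 3

end Generic

end MultilinearHilbert

/-- Here `n = d + 1` is the number of functions, and the vectors lie in `ℝ^(n-1) = ℝ^d`. -/
theorem mainTheorem1 (k d : ℕ) (hk : 2 ≤ k) (hn : 4 ≤ d + 1) :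
    MultilinearHilbert.HoldsForGeneric (fun α : Fin k → Fin d → ℝ =>
      ¬ MultilinearHilbert.SatisfiesSomeHolderEstimate (MultilinearHilbert.nHT α)) := by
  open MultilinearHilbert in
  set j₀ : Fin k := ⟨0, by omega⟩ with hj₀
  set j₁ : Fin k := ⟨1, by omega⟩ with hj₁
  have h01 : j₀ ≠ j₁ := by simp [hj₀, hj₁]
  have hd : 3 ≤ d + 1 := by omega
  refine ⟨chirpDet hn j₀ j₁ * ∏ j ∈ (Finset.univ.erase j₀).erase j₁, formDet hd j₀ j₁ j,
    mul_ne_zero (chirpDet_ne_zero hn h01) (Finset.prod_ne_zero_iff.2 fun j hj => ?_),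
    fun α hα => ?_⟩
  · simp only [Finset.mem_erase, Finset.mem_univ, and_true] at hj
    exact formDet_ne_zero hn h01 hj.2 hj.1
  · rw [map_mul, map_prod, mul_ne_zero_iff, Finset.prod_ne_zero_iff, eval_chirpDet] at hα
    obtain ⟨a, hau, hav, havv, hauv⟩ := exists_chirp_coeff hn α hα.1
    obtain ⟨w, hw0, hw1, hw⟩ := exists_direction hd α j₀ j₁
    refine not_satisfiesSomeHolderEstimate h01 hw0 hw1 (fun j hj0 hj1 => ?_) hau hav havv
      (by rw [hauv]; exact one_ne_zero)
    rw [hw]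
    exact hα.2 j (by simp [hj0, hj1])
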